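/- Let $\mathfrak g=\mathfrak v\oplus\mathfrak z$ be an H-type Lie algebra: an orthogonal sum of finite-dimensional Euclidean spaces, with a Lie bracket whose only non-zero part is an alternating bilinear map $[\cdot,\cdot]:\mathfrak v\times\mathfrak v\to\mathfrak z$, such that for $\mu\in\mathfrak z^*\cong\mathfrak z$ the map $J_\mu$ of $\mathfrak v$ defined by $\langle J_\mu x,y\rangle=\mu([x,y])$ satisfies $J_\mu^2=-|\mu|^2I$. Let $2n=\dim\mathfrak v$, and let $G=\mathfrak v\times\mathfrak z$ be the corresponding group in exponential coordinates. Let $\mathcal F(\mathbb C^n)$ be Bargmann-Fock space, the Hilbert space of holomorphic $F$ on $\mathbb C^n$ with $\|F\|^2=\pi^{-n}\int_{\mathbb C^n}|F(\zeta)|^2e^{-|\zeta|^2}d\zeta<\infty$. For $h>0$ and $(z,t)\in\mathbb C^n\times\mathbb R$ let $$\pi_h(z,t)F(\zeta)=e^{iht-\sqrt{h/2}\,\zeta\cdot\bar z-\frac h4|z|^2}F\big(\zeta+\sqrt{h/2}\,z\big),$$ and for $\mu\in\mathfrak z^*\setminus\{0\}$ let $\pi_\mu(x,u)=\pi_{|\mu|}\big(R_\mu^{t}x,\mu(u)/|\mu|\big)$,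 where $R_\mu:\mathbb C^n=\mathbb R^{2n}\to\mathfrak v$ is any real linear isometry carrying multiplication by $i$ to $J_\mu/|\mu|$. For $\lambda\in\mathfrak z^*\setminus\{0\}$ and a unit vector $\nu\in\mathfrak v$ put $$\gamma_{\nu,\lambda}(s)=\Big(e^{sJ_\lambda}J_\lambda^{-1}\nu,\ \frac{s\lambda}{2|\lambda|^2}\Big),\qquad \mathcal J_{\nu,\lambda}(\mu)=\frac{|\lambda|}{2\pi}\int_0^{2\pi/|\lambda|}\pi_\mu(\gamma_{\nu,\lambda}(s))\,ds,$$ $$\mathcal N_{\nu,\lambda}(\mu)=\mathcal J_{\nu,\lambda}(\mu)^*\mathcal J_{\nu,\lambda}(\mu),\qquad \mathcal N_\lambda(\mu)=\int_{U(\lambda)}\mathcal N_{U\nu,\lambda}(\mu)\,dU,$$ where the integrals of operators are taken in the strong sense, $U(\lambda)$ is the group of orthogonal transformations of $\mathfrak v$ commuting with $J_\lambda$, and $dU$ is its normalized Haar measure. Call a bounded self-adjoint operator invertible if zero is not an eigenvalue, i.e. if it is injective with dense range, so that it has a densely defined (possibly unbounded) inverse. Fix $\lambda\in\mathfrak z^*\setminus\{0\}$.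 (a) If $n=1$ (the first Heisenberg group), then $\mathcal N_\lambda(\mu):\mathcal F(\mathbb C^n)\to\mathcal F(\mathbb C^n)$ is invertible for every $\mu=2k|\lambda|\lambda$ with $k$ an odd integer (that is, $\mu=2k\lambda^2$, $k$ odd, when $\mathfrak z^*$ is identified with $\mathbb R$). (b) If $n>1$, then $\mathcal N_\lambda(\mu):\mathcal F(\mathbb C^n)\to\mathcal F(\mathbb C^n)$ is invertible for every compatible $\mu\neq0$, that is, for every $\mu\in\mathfrak z^*\setminus\{0\}$ with $\mu\cdot\lambda=2k|\lambda|^3$ for some $k\in\mathbb Z$. -/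

import Mathlib

open MeasureTheory Filter Topology
open scoped InnerProductSpace

noncomputable section

/-! ### Bargmann-Fock space -/

/-- The Hermitian space `ℂⁿ`. -/
abbrev CSpace (n : ℕ) : Type := EuclideanSpace ℂ (Fin n)

/-- The Gaussian measure `π⁻ⁿ exp (-|ζ|²) dζ` on `ℂⁿ`. -/
def fockMeasure (n : ℕ) : Measure (CSpace n) :=
  ENNReal.ofReal ((Real.pi ^ n)⁻¹) •
    (volume : Measure (CSpace n)).withDensity (fun ζ => ENNReal.ofReal (Real.exp (-‖ζ‖ ^ 2)))

/-- The holomorphic functions on `ℂⁿ` which are square integrable for the Gaussian measure. -/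
def fockSubmodule (n : ℕ) : Submodule ℂ (CSpace n → ℂ) where
  carrier := {F | Differentiable ℂ F ∧ MemLp F 2 (fockMeasure n)}
  zero_mem' := ⟨differentiable_const 0, MemLp.zero⟩
  add_mem' := fun h₁ h₂ => ⟨h₁.1.add h₂.1, h₁.2.add h₂.2⟩
  smul_mem' := fun c _ h => ⟨h.1.const_smul c, h.2.const_smul c⟩

/-- Bargmann-Fock space `𝓕(ℂⁿ)`. It is a type of its own, so that its topology is that of the
Hilbert norm, and not that of pointwise convergence. -/
def FockSpace (n : ℕ) : Type := ↥(fockSubmodule n)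

namespace FockSpace

variable {n : ℕ}

instance : AddCommGroup (FockSpace n) := inferInstanceAs (AddCommGroup ↥(fockSubmodule n))

instance : Module ℂ (FockSpace n) := inferInstanceAs (Module ℂ ↥(fockSubmodule n))

/-- The holomorphic function underlying an element of Fock space. -/
def toFun (F : FockSpace n) : CSpace n → ℂ := Subtype.val (p := (· ∈ fockSubmodule n)) F

instance : CoeFun (FockSpace n) (fun _ => CSpace n → ℂ) := ⟨toFun⟩

theorem ext {F G : FockSpace n} (h : ∀ ζ, F ζ = G ζ) : F = G := Subtype.ext (funext h)

theorem differentiable (F : FockSpace n) : Differentiable ℂ (F : CSpace n → ℂ) := F.2.1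

theorem memLp (F : FockSpace n) : MemLp (F : CSpace n → ℂ) 2 (fockMeasure n) := F.2.2

@[simp] theorem add_apply (F G : FockSpace n) (ζ : CSpace n) : (F + G) ζ = F ζ + G ζ := rfl

@[simp] theorem sub_apply (F G : FockSpace n) (ζ : CSpace n) : (F - G) ζ = F ζ - G ζ := rfl

@[simp] theorem smul_apply (c : ℂ) (F : FockSpace n) (ζ : CSpace n) : (c • F) ζ = c * F ζ := rfl

/-- The class of an element of Fock space in `L²` of the Gaussian measure. -/
def toL2 : FockSpace n →ₗ[ℂ] Lp ℂ 2 (fockMeasure n) where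
  toFun F := F.memLp.toLp _
  map_add' _ _ := rfl
  map_smul' _ _ := rfl

theorem lintegral_fockMeasure {f : CSpace n → ENNReal} (hf : Measurable f) :
    ∫⁻ ζ, f ζ ∂(fockMeasure n) = ENNReal.ofReal ((Real.pi ^ n)⁻¹) *
      ∫⁻ ζ, ENNReal.ofReal (Real.exp (-‖ζ‖ ^ 2)) * f ζ := by
  rw [fockMeasure, lintegral_smul_measure, lintegral_withDensity_eq_lintegral_mul _ (by fun_prop) hf]
  rfl

instance : IsProbabilityMeasure (fockMeasure n) := by
  constructor
  have h := lintegral_fockMeasure (n := n) (f := fun _ => 1) measurable_const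
  simp only [lintegral_const, one_mul, mul_one] at h
  rw [h]
  have hg := GaussianFourier.integral_rexp_neg_mul_sq_norm (V := CSpace n) (b := 1) one_pos
  have hdim : Module.finrank ℝ (CSpace n) = 2 * n := by
    rw [← Module.finrank_mul_finrank ℝ ℂ (CSpace n)]
    simp
  rw [hdim] at hg
  have h2 : ((2 * n : ℕ) : ℝ) / 2 = n := by push_cast; ring
  rw [h2, Real.rpow_natCast, div_one] at hg
  have hint : Integrable (fun ζ : CSpace n => Real.exp (-‖ζ‖ ^ 2)) := by
    by_contra hcon
    have := integral_undef hcon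
    simp only [neg_mul, one_mul] at hg
    rw [this] at hg
    exact (pow_pos Real.pi_pos n).ne hg
  rw [← ofReal_integral_eq_lintegral_ofReal hint (ae_of_all _ fun ζ => (Real.exp_pos _).le)]
  simp only [neg_mul, one_mul] at hg
  rw [hg, ← ENNReal.ofReal_mul (by positivity), inv_mul_cancel₀ (by positivity), ENNReal.ofReal_one]

theorem ae_volume_of_ae {p : CSpace n → Prop} (h : ∀ᵐ ζ ∂(fockMeasure n), p ζ) :
    ∀ᵐ ζ ∂(volume : Measure (CSpace n)), p ζ := by
  rw [fockMeasure, Measure.ae_ennreal_smul_measure_iff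
    (by simp only [ne_eq, ENNReal.ofReal_eq_zero, not_le]; positivity),
    ae_withDensity_iff (by fun_prop)] at h
  filter_upwards [h] with ζ hζ
  apply hζ
  simp only [ne_eq, ENNReal.ofReal_eq_zero, not_le]
  positivity

theorem toL2_injective : Function.Injective (toL2 (n := n)) := by
  intro F G h
  have h1 : (F : CSpace n → ℂ) =ᵐ[fockMeasure n] G := (MemLp.toLp_eq_toLp_iff F.memLp G.memLp).1 h
  have h2 := ae_volume_of_ae h1
  have h3 := Continuous.ae_eq_iff_eq (volume : Measure (CSpace n))
    F.differentiable.continuous G.differentiable.continuous |>.1 h2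
  exact ext fun ζ => congrFun h3 ζ

/-- The inner product `⟪F, G⟫ = π⁻ⁿ ∫ conj (F ζ) G ζ exp (-|ζ|²) dζ` of Fock space (conjugate
linear in the first variable). -/
@[reducible]
def innerCore : InnerProductSpace.Core ℂ (FockSpace n) where
  inner F G := ⟪toL2 F, toL2 G⟫_ℂ
  conj_inner_symm F G := inner_conj_symm _ _
  re_inner_nonneg F := inner_self_nonneg
  add_left F G K := by rw [map_add, inner_add_left]
  smul_left F G c := by rw [map_smul, inner_smul_left]
  definite F h := by
    apply toL2_injective
    rw [map_zero]
    exact inner_self_eq_zero.1 h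

instance : NormedAddCommGroup (FockSpace n) := innerCore.toNormedAddCommGroup

instance : InnerProductSpace ℂ (FockSpace n) := InnerProductSpace.ofCore innerCore.toCore

theorem inner_def (F G : FockSpace n) : ⟪F, G⟫_ℂ = ⟪toL2 F, toL2 G⟫_ℂ := rfl

theorem norm_toL2 (F : FockSpace n) : ‖toL2 F‖ = ‖F‖ := by
  rw [@norm_eq_sqrt_re_inner ℂ, @norm_eq_sqrt_re_inner ℂ _ _ _ _ F, inner_def]

theorem ofReal_norm_eq (F : FockSpace n) :
    ENNReal.ofReal ‖F‖ = eLpNorm (F : CSpace n → ℂ) 2 (fockMeasure n) := by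
  rw [← norm_toL2]
  exact (ofReal_norm _).trans (Lp.enorm_toLp (hf := F.memLp))

/-! ### Translations -/

/-- The function `ζ ↦ exp (-ζ · conj a - |a|² / 2) F (ζ + a)`. -/
def translateFun (a : CSpace n) (F : CSpace n → ℂ) (ζ : CSpace n) : ℂ :=
  Complex.exp (-⟪a, ζ⟫_ℂ - (‖a‖ : ℂ) ^ 2 / 2) * F (ζ + a)

theorem norm_translateFun_sq (a : CSpace n) (F : CSpace n → ℂ) (ζ : CSpace n) :
    Real.exp (-‖ζ‖ ^ 2) * ‖translateFun a F ζ‖ ^ 2 =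
      Real.exp (-‖ζ + a‖ ^ 2) * ‖F (ζ + a)‖ ^ 2 := by
  rw [translateFun, norm_mul, mul_pow, Complex.norm_exp, ← mul_assoc, ← Real.exp_nat_mul,
    ← Real.exp_add]
  congr 2
  have h : ‖ζ + a‖ ^ 2 = ‖ζ‖ ^ 2 + 2 * (⟪a, ζ⟫_ℂ).re + ‖a‖ ^ 2 := by
    rw [add_comm ζ a, @norm_add_sq ℂ]
    simp only [RCLike.re_to_complex]
    ring
  have h2 : ((‖a‖ : ℂ) ^ 2 / 2).re = ‖a‖ ^ 2 / 2 := by norm_cast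
  rw [h, Complex.sub_re, h2, Complex.neg_re]
  push_cast
  ring

theorem eLpNorm_two_sq {F : CSpace n → ℂ} (hF : Continuous F) :
    eLpNorm F 2 (fockMeasure n) ^ 2 = ENNReal.ofReal ((Real.pi ^ n)⁻¹) *
      ∫⁻ ζ, ENNReal.ofReal (Real.exp (-‖ζ‖ ^ 2) * ‖F ζ‖ ^ 2) := by
  have h := eLpNorm_nnreal_pow_eq_lintegral (f := F) (μ := fockMeasure n) (p := 2) two_ne_zero
  norm_num at h
  rw [h, lintegral_fockMeasure (by fun_prop)]
  congr 1
  apply lintegral_congr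
  intro ζ
  rw [ENNReal.ofReal_mul (Real.exp_pos _).le, ENNReal.ofReal_pow (norm_nonneg _), ofReal_norm]

theorem differentiable_translateFun (a : CSpace n) (F : FockSpace n) :
    Differentiable ℂ (translateFun a F) := by
  have h1 : Differentiable ℂ (fun ζ : CSpace n => ⟪a, ζ⟫_ℂ) := (innerSL ℂ a).differentiable
  have h2 : Differentiable ℂ (fun ζ : CSpace n => F (ζ + a)) :=
    F.differentiable.comp (differentiable_id.add_const a)
  exact ((h1.neg.sub_const _).cexp).mul h2

theorem eLpNorm_translateFun (a : CSpace n) (F : FockSpace n) :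
    eLpNorm (translateFun a F) 2 (fockMeasure n) =
      eLpNorm (F : CSpace n → ℂ) 2 (fockMeasure n) := by
  have h : eLpNorm (translateFun a F) 2 (fockMeasure n) ^ 2 =
      eLpNorm (F : CSpace n → ℂ) 2 (fockMeasure n) ^ 2 := by
    rw [eLpNorm_two_sq (differentiable_translateFun a F).continuous,
      eLpNorm_two_sq F.differentiable.continuous]
    simp only [norm_translateFun_sq]
    congr 1
    exact lintegral_add_right_eq_self
      (fun ζ => ENNReal.ofReal (Real.exp (-‖ζ‖ ^ 2) * ‖F ζ‖ ^ 2)) a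
  exact (ENNReal.pow_right_strictMono two_ne_zero).injective h

/-- The unitary operator `F ↦ exp (-ζ · conj a - |a|² / 2) F (ζ + a)` of Fock space. -/
def translate (a : CSpace n) : FockSpace n →ₗᵢ[ℂ] FockSpace n where
  toFun F := ⟨translateFun a F, differentiable_translateFun a F,
    (differentiable_translateFun a F).continuous.aestronglyMeasurable, by
      rw [eLpNorm_translateFun]; exact F.memLp.2⟩
  map_add' F G := ext fun ζ => mul_add _ _ _
  map_smul' c F := ext fun ζ => mul_left_comm _ _ _
  norm_map' F := by
    rw [← ENNReal.ofReal_eq_ofReal_iff (norm_nonneg _) (norm_nonneg _), ofReal_norm_eq,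
      ofReal_norm_eq]
    exact eLpNorm_translateFun a F

theorem translate_apply (a : CSpace n) (F : FockSpace n) (ζ : CSpace n) :
    translate a F ζ = Complex.exp (-⟪a, ζ⟫_ℂ - (‖a‖ : ℂ) ^ 2 / 2) * F (ζ + a) := rfl

/-! ### Completeness -/

theorem norm_apply_zero_le (F : FockSpace n) : ‖F 0‖ ≤ ‖F‖ := by
  have hc := F.differentiable.continuous
  set κ : Measure ℝ := volume.restrict (Set.Ioc 0 (2 * Real.pi)) with hκ
  have hmean : ∀ ζ : CSpace n, ENNReal.ofReal (2 * Real.pi) * ‖F 0‖ₑ ≤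
      ∫⁻ θ, ‖F (Complex.exp (θ * Complex.I) • ζ)‖ₑ ∂κ := by
    intro ζ
    have hd : Differentiable ℂ (fun t : ℂ => F (t • ζ)) :=
      F.differentiable.comp (differentiable_id.smul_const ζ)
    have h1 := (hd.diffContOnCl (s := Metric.ball 0 |(1 : ℝ)|)).circleAverage
    rw [Real.circleAverage_def, zero_smul, intervalIntegral.integral_of_le
      (by positivity)] at h1
    have h2 : (2 * Real.pi) • F 0 = ∫ θ, F (circleMap 0 1 θ • ζ) ∂κ := by
      rw [← h1, smul_smul, mul_inv_cancel₀ (by positivity), one_smul]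
    have h3 : ENNReal.ofReal (2 * Real.pi) * ‖F 0‖ₑ = ‖(2 * Real.pi) • F 0‖ₑ := by
      rw [enorm_smul, Real.enorm_eq_ofReal (by positivity)]
    rw [h3, h2]
    refine (enorm_integral_le_lintegral_enorm _).trans (le_of_eq ?_)
    simp [circleMap]
  have hrot : ∀ θ : ℝ, ∫⁻ ζ, ‖F (Complex.exp (θ * Complex.I) • ζ)‖ₑ ∂(fockMeasure n) =
      ∫⁻ ζ, ‖F ζ‖ₑ ∂(fockMeasure n) := by
    intro θ
    have hn : ‖Complex.exp (θ * Complex.I)‖ = 1 := Complex.norm_exp_ofReal_mul_I θ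
    have hm : Measurable fun ζ => ‖F (Complex.exp (θ * Complex.I) • ζ)‖ₑ :=
      (hc.comp (continuous_const_smul (Complex.exp (θ * Complex.I)))).enorm.measurable
    rw [lintegral_fockMeasure hm, lintegral_fockMeasure hc.enorm.measurable]
    congr 1
    let e : CSpace n →ₗᵢ[ℝ] CSpace n :=
      { toFun := fun ζ => Complex.exp (θ * Complex.I) • ζ
        map_add' := fun x y => smul_add _ x y
        map_smul' := fun c x => smul_comm _ c x
        norm_map' := fun x => by
          change ‖Complex.exp (θ * Complex.I) • x‖ = ‖x‖
          rw [norm_smul, hn, one_mul] }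
    have hmp := (e.toLinearIsometryEquiv rfl).measurePreserving
    have := hmp.lintegral_comp
      (f := fun ζ => ENNReal.ofReal (Real.exp (-‖ζ‖ ^ 2)) * ‖F ζ‖ₑ) (by fun_prop)
    rw [← this]
    apply lintegral_congr
    intro ζ
    rw [LinearIsometryEquiv.norm_map]
    rfl
  have h1 : ENNReal.ofReal (2 * Real.pi) * ‖F 0‖ₑ ≤
      ENNReal.ofReal (2 * Real.pi) * ∫⁻ ζ, ‖F ζ‖ₑ ∂(fockMeasure n) := by
    calc ENNReal.ofReal (2 * Real.pi) * ‖F 0‖ₑ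
        = ∫⁻ _ : CSpace n, ENNReal.ofReal (2 * Real.pi) * ‖F 0‖ₑ ∂(fockMeasure n) := by simp
      _ ≤ ∫⁻ ζ, ∫⁻ θ, ‖F (Complex.exp (θ * Complex.I) • ζ)‖ₑ ∂κ ∂(fockMeasure n) :=
        lintegral_mono hmean
      _ = ∫⁻ θ, ∫⁻ ζ, ‖F (Complex.exp (θ * Complex.I) • ζ)‖ₑ ∂(fockMeasure n) ∂κ := by
        apply lintegral_lintegral_swap
        apply Measurable.aemeasurable
        apply Continuous.measurable
        unfold Function.uncurry
        fun_prop
      _ = _ := by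
        simp only [hrot, lintegral_const, hκ, Measure.restrict_apply_univ, Real.volume_Ioc,
          sub_zero]
        rw [mul_comm]
  have h2 : ‖F 0‖ₑ ≤ ∫⁻ ζ, ‖F ζ‖ₑ ∂(fockMeasure n) :=
    (ENNReal.mul_le_mul_iff_right (by simp [Real.pi_pos]) ENNReal.ofReal_ne_top).1 h1
  rw [← eLpNorm_one_eq_lintegral_enorm] at h2
  have h3 := h2.trans (eLpNorm_le_eLpNorm_of_exponent_le one_le_two hc.aestronglyMeasurable)
  rw [← ofReal_norm_eq, ← ofReal_norm] at h3
  exact (ENNReal.ofReal_le_ofReal_iff (norm_nonneg _)).1 h3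

theorem norm_apply_le (F : FockSpace n) (ζ : CSpace n) :
    ‖F ζ‖ ≤ Real.exp (‖ζ‖ ^ 2 / 2) * ‖F‖ := by
  have h := norm_apply_zero_le (translate ζ F)
  rw [LinearIsometry.norm_map, translate_apply, norm_mul, Complex.norm_exp, inner_zero_right,
    zero_add] at h
  have h2 : ((‖ζ‖ : ℂ) ^ 2 / 2).re = ‖ζ‖ ^ 2 / 2 := by norm_cast
  rw [Complex.sub_re, h2, neg_zero, Complex.zero_re, zero_sub, Real.exp_neg] at h
  rwa [inv_mul_le_iff₀ (Real.exp_pos _)] at h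

theorem norm_fderiv_le (F : FockSpace n) (ζ : CSpace n) :
    ‖fderiv ℂ (F : CSpace n → ℂ) ζ‖ ≤ Real.exp ((‖ζ‖ + 1) ^ 2 / 2) * ‖F‖ := by
  have hC : 0 ≤ Real.exp ((‖ζ‖ + 1) ^ 2 / 2) * ‖F‖ := by positivity
  refine ContinuousLinearMap.opNorm_le_bound _ hC fun v => ?_
  rcases eq_or_ne v 0 with rfl | hv
  · simp
  have hv' : 0 < ‖v‖ := norm_pos_iff.2 hv
  have hd : Differentiable ℂ (fun t : ℂ => F (ζ + t • v)) :=
    F.differentiable.comp ((differentiable_id.smul_const v).const_add ζ)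
  have h1 : deriv (fun t : ℂ => F (ζ + t • v)) 0 = fderiv ℂ (F : CSpace n → ℂ) ζ v :=
    (F.differentiable ζ).lineDeriv_eq_fderiv
  rw [← h1]
  have h2 := Complex.norm_deriv_le_of_forall_mem_sphere_norm_le (c := 0) (R := ‖v‖⁻¹)
    (C := Real.exp ((‖ζ‖ + 1) ^ 2 / 2) * ‖F‖) (inv_pos.2 hv') hd.diffContOnCl ?_
  · rwa [div_inv_eq_mul] at h2
  intro t ht
  rw [mem_sphere_zero_iff_norm] at ht
  refine (norm_apply_le F _).trans ?_
  have h3 : ‖ζ + t • v‖ ≤ ‖ζ‖ + 1 := by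
    refine (norm_add_le _ _).trans ?_
    rw [norm_smul, ht, inv_mul_cancel₀ hv'.ne']
  gcongr

theorem exists_limit {f : ℕ → FockSpace n} (hf : CauchySeq f) :
    ∃ g : CSpace n → ℂ, Differentiable ℂ g ∧ ∀ ζ, Tendsto (fun m => f m ζ) atTop (𝓝 (g ζ)) := by
  have hcau : ∀ ε > 0, ∃ N, ∀ p ≥ N, ∀ q ≥ N, ‖f p - f q‖ < ε := by
    simpa only [dist_eq_norm] using Metric.cauchySeq_iff.1 hf
  have key : ∀ r : ℝ, 0 ≤ r → ∀ ε > 0, ∃ N, ∀ p ≥ N, ∀ q ≥ N,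
      Real.exp ((r + 1) ^ 2 / 2) * ‖f p - f q‖ < ε := by
    intro r hr ε hε
    obtain ⟨N, hN⟩ := hcau (ε / Real.exp ((r + 1) ^ 2 / 2)) (by positivity)
    refine ⟨N, fun p hp q hq => ?_⟩
    have := hN p hp q hq
    rwa [lt_div_iff₀' (Real.exp_pos _)] at this
  have hder : ∀ p q ζ, fderiv ℂ (f p : CSpace n → ℂ) ζ - fderiv ℂ (f q : CSpace n → ℂ) ζ =
      fderiv ℂ ((f p - f q : FockSpace n) : CSpace n → ℂ) ζ := fun p q ζ =>
    (fderiv_sub ((f p).differentiable ζ) ((f q).differentiable ζ)).symm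
  have hlim : ∀ ζ, ∃ c, Tendsto (fun m => f m ζ) atTop (𝓝 c) := by
    intro ζ
    apply cauchySeq_tendsto_of_complete
    rw [Metric.cauchySeq_iff]
    intro ε hε
    obtain ⟨N, hN⟩ := key ‖ζ‖ (norm_nonneg _) ε hε
    refine ⟨N, fun p hp q hq => lt_of_le_of_lt ?_ (hN p hp q hq)⟩
    rw [dist_eq_norm]
    refine (norm_apply_le (f p - f q) ζ).trans ?_
    gcongr
    linarith
  have hlim' : ∀ ζ, ∃ c, Tendsto (fun m => fderiv ℂ (f m : CSpace n → ℂ) ζ) atTop (𝓝 c) := by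
    intro ζ
    apply cauchySeq_tendsto_of_complete
    rw [Metric.cauchySeq_iff]
    intro ε hε
    obtain ⟨N, hN⟩ := key ‖ζ‖ (norm_nonneg _) ε hε
    refine ⟨N, fun p hp q hq => lt_of_le_of_lt ?_ (hN p hp q hq)⟩
    rw [dist_eq_norm, hder]
    exact norm_fderiv_le (f p - f q) ζ
  choose g hg using hlim
  choose g' hg' using hlim'
  refine ⟨g, fun ζ₀ => ?_, hg⟩
  have hu : TendstoUniformlyOn (fun m ζ => fderiv ℂ (f m : CSpace n → ℂ) ζ) g' atTop
      (Metric.ball 0 (‖ζ₀‖ + 1)) := by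
    refine UniformCauchySeqOn.tendstoUniformlyOn_of_tendsto ?_ (fun ζ _ => hg' ζ)
    rw [Metric.uniformCauchySeqOn_iff]
    intro ε hε
    obtain ⟨N, hN⟩ := key (‖ζ₀‖ + 1) (by positivity) ε hε
    refine ⟨N, fun p hp q hq ζ hζ => lt_of_le_of_lt ?_ (hN p hp q hq)⟩
    rw [dist_eq_norm, hder]
    refine (norm_fderiv_le (f p - f q) ζ).trans ?_
    rw [mem_ball_zero_iff] at hζ
    gcongr
  have := hasFDerivAt_of_tendstoUniformlyOn (x := ζ₀) Metric.isOpen_ball hu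
    (fun m ζ _ => ((f m).differentiable ζ).hasFDerivAt) (fun ζ _ => hg ζ) (by simp)
  exact this.differentiableAt

instance : CompleteSpace (FockSpace n) := by
  refine Metric.complete_of_cauchySeq_tendsto fun f hf => ?_
  obtain ⟨g, hgd, hg⟩ := exists_limit hf
  let L : FockSpace n →ₗᵢ[ℂ] Lp ℂ 2 (fockMeasure n) := ⟨toL2, norm_toL2⟩
  obtain ⟨G, hG⟩ := cauchySeq_tendsto_of_complete (L.isometry.uniformContinuous.comp_cauchySeq hf)
  have hmeas := tendstoInMeasure_of_tendsto_Lp hG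
  obtain ⟨ns, hns, hae⟩ := hmeas.exists_seq_tendsto_ae
  have hcoe : ∀ m, (L (f m) : CSpace n → ℂ) =ᵐ[fockMeasure n] f m := fun m =>
    MemLp.coeFn_toLp (f m).memLp
  have hgG : (G : CSpace n → ℂ) =ᵐ[fockMeasure n] g := by
    filter_upwards [hae, ae_all_iff.2 hcoe] with ζ h1 h2
    refine tendsto_nhds_unique h1 ?_
    have := (hg ζ).comp hns.tendsto_atTop
    refine this.congr fun i => ?_
    exact (h2 (ns i)).symm
  have hgm : MemLp g 2 (fockMeasure n) := (memLp_congr_ae hgG).1 (Lp.memLp G)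
  let K : FockSpace n := ⟨g, hgd, hgm⟩
  have hK : L K = G := by
    apply Lp.ext
    exact (MemLp.coeFn_toLp hgm).trans hgG.symm
  refine ⟨K, ?_⟩
  rw [L.isometry.isEmbedding.tendsto_nhds_iff, hK]
  exact hG

/-! ### Strong continuity of translations -/

/-- Evaluation at a point, as a bounded functional. -/
def evalL (ζ : CSpace n) : FockSpace n →L[ℂ] ℂ :=
  LinearMap.mkContinuous
    { toFun := fun F => F ζ
      map_add' := fun _ _ => rfl
      map_smul' := fun _ _ => rfl }
    (Real.exp (‖ζ‖ ^ 2 / 2)) (fun F => norm_apply_le F ζ)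

theorem evalL_apply (ζ : CSpace n) (F : FockSpace n) : evalL ζ F = F ζ := rfl

theorem translate_neg_translate (a : CSpace n) (F : FockSpace n) :
    translate (-a) (translate a F) = F := by
  refine ext fun ζ => ?_
  rw [translate_apply, translate_apply, ← mul_assoc, ← Complex.exp_add, neg_add_cancel_right,
    norm_neg, inner_neg_left, inner_add_right, inner_neg_right, inner_self_eq_norm_sq_to_K]
  have : -(-⟪a, ζ⟫_ℂ) - (‖a‖ : ℂ) ^ 2 / 2 +
      (-(⟪a, ζ⟫_ℂ + -(‖a‖ : ℂ) ^ 2) - (‖a‖ : ℂ) ^ 2 / 2) = 0 := by ring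
  erw [this]
  rw [Complex.exp_zero, one_mul]

theorem inner_translate_left (a : CSpace n) (F G : FockSpace n) :
    ⟪translate a F, G⟫_ℂ = ⟪F, translate (-a) G⟫_ℂ := by
  have h := translate_neg_translate (-a) G
  rw [neg_neg] at h
  conv_lhs => rw [← h]
  exact LinearIsometry.inner_map_map _ _ _

theorem continuous_inner_translate (F G : FockSpace n) :
    Continuous fun a : CSpace n => ⟪G, translate a F⟫_ℂ := by
  let S : Submodule ℂ (FockSpace n) :=
    Submodule.span ℂ (Set.range fun ζ => (InnerProductSpace.toDual ℂ (FockSpace n)).symm (evalL ζ))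
  have hS : Sᗮ = ⊥ := by
    rw [eq_bot_iff]
    intro K hK
    rw [Submodule.mem_bot]
    refine ext fun ζ => ?_
    have := (Submodule.mem_orthogonal _ _).1 hK _ (Submodule.subset_span ⟨ζ, rfl⟩)
    rwa [InnerProductSpace.toDual_symm_apply, evalL_apply] at this
  have hdense : G ∈ closure (S : Set (FockSpace n)) := by
    have := (Submodule.topologicalClosure_eq_top_iff (K := S)).2 hS
    rw [← Submodule.topologicalClosure_coe, this]
    trivial
  have hcont : ∀ K ∈ S, Continuous fun a : CSpace n => ⟪K, translate a F⟫_ℂ := by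
    intro K hK
    induction hK using Submodule.span_induction with
    | mem K hK =>
      obtain ⟨ζ, rfl⟩ := hK
      simp only [InnerProductSpace.toDual_symm_apply, evalL_apply, translate_apply]
      have := F.differentiable.continuous
      have h2 : Continuous fun a : CSpace n => F (ζ + a) :=
        this.comp (continuous_const.add continuous_id)
      fun_prop
    | zero => simpa only [inner_zero_left] using continuous_const
    | add K K' _ _ h h' => simp only [inner_add_left]; fun_prop
    | smul c K _ h => simp only [inner_smul_left]; fun_prop
  refine continuous_of_uniform_approx_of_continuous fun u hu => ?_
  obtain ⟨ε, hε, hεu⟩ := Metric.mem_uniformity_dist.1 hu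
  obtain ⟨K, hK, hGK⟩ := Metric.mem_closure_iff.1 hdense (ε / (‖F‖ + 1)) (by positivity)
  refine ⟨_, hcont K hK, fun a => hεu ?_⟩
  rw [dist_eq_norm, ← inner_sub_left]
  refine (norm_inner_le_norm _ _).trans_lt ?_
  rw [LinearIsometry.norm_map, ← dist_eq_norm]
  rw [lt_div_iff₀ (by positivity)] at hGK
  nlinarith [dist_nonneg (x := G) (y := K)]

theorem continuous_translate (F : FockSpace n) :
    Continuous fun a : CSpace n => translate a F := by
  refine continuous_iff_continuousAt.2 fun b => ?_
  rw [ContinuousAt, tendsto_iff_norm_sub_tendsto_zero]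
  have h1 : ∀ a, ‖translate a F - translate b F‖ ^ 2 =
      2 * ‖F‖ ^ 2 - 2 * (⟪translate b F, translate a F⟫_ℂ).re := by
    intro a
    rw [← norm_neg, neg_sub, @norm_sub_sq ℂ, LinearIsometry.norm_map, LinearIsometry.norm_map]
    simp only [RCLike.re_to_complex]
    ring
  have h2 : Continuous fun a => ‖translate a F - translate b F‖ ^ 2 := by
    simp only [h1]
    have := Complex.continuous_re.comp (continuous_inner_translate F (translate b F))
    exact continuous_const.sub (continuous_const.mul this)
  have h3 := (Real.continuous_sqrt.comp h2).tendsto b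
  simpa [Function.comp_def, Real.sqrt_sq (norm_nonneg _)] using h3

/-! ### The Bargmann-Fock representation of the Heisenberg group -/

/-- The Bargmann-Fock representation `π_h (z, t)`, `h > 0`, of the Heisenberg group `ℂⁿ × ℝ`. -/
def heisenbergRep (h : ℝ) (z : CSpace n) (t : ℝ) : FockSpace n →L[ℂ] FockSpace n :=
  Complex.exp ((h * t : ℝ) * Complex.I) • (translate (√(h / 2) • z)).toContinuousLinearMap

theorem heisenbergRep_apply {h : ℝ} (hh : 0 < h) (z : CSpace n) (t : ℝ) (F : FockSpace n)
    (ζ : CSpace n) :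
    heisenbergRep h z t F ζ = Complex.exp (Complex.I * h * t - √(h / 2) * ⟪z, ζ⟫_ℂ
      - h / 4 * (‖z‖ : ℂ) ^ 2) * F (ζ + √(h / 2) • z) := by
  change Complex.exp ((h * t : ℝ) * Complex.I) * (Complex.exp (-⟪√(h / 2) • z, ζ⟫_ℂ -
    (‖√(h / 2) • z‖ : ℂ) ^ 2 / 2) * F (ζ + √(h / 2) • z)) = _
  rw [← mul_assoc, ← Complex.exp_add]
  congr 2
  have h1 : ((√(h / 2) : ℝ) : ℂ) ^ 2 = h / 2 := by
    rw [← Complex.ofReal_pow, Real.sq_sqrt (by positivity)]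
    push_cast
    rfl
  have h2 : ⟪√(h / 2) • z, ζ⟫_ℂ = √(h / 2) * ⟪z, ζ⟫_ℂ := by
    rw [← Complex.coe_smul, inner_smul_left, Complex.conj_ofReal]
  rw [h2, norm_smul, Real.norm_of_nonneg (Real.sqrt_nonneg _)]
  push_cast
  rw [mul_pow, h1]
  ring

theorem norm_heisenbergRep_apply (h : ℝ) (z : CSpace n) (t : ℝ) (F : FockSpace n) :
    ‖heisenbergRep h z t F‖ = ‖F‖ := by
  change ‖Complex.exp ((h * t : ℝ) * Complex.I) • translate (√(h / 2) • z) F‖ = ‖F‖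
  rw [norm_smul, Complex.norm_exp_ofReal_mul_I, one_mul, LinearIsometry.norm_map]

theorem norm_heisenbergRep_le (h : ℝ) (z : CSpace n) (t : ℝ) : ‖heisenbergRep h z t‖ ≤ 1 :=
  ContinuousLinearMap.opNorm_le_bound _ zero_le_one fun F => by
    rw [norm_heisenbergRep_apply, one_mul]

theorem adjoint_heisenbergRep (h : ℝ) (z : CSpace n) (t : ℝ) :
    ContinuousLinearMap.adjoint (heisenbergRep h z t) = heisenbergRep h (-z) (-t) := by
  symm
  rw [ContinuousLinearMap.eq_adjoint_iff]
  intro F G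
  change ⟪Complex.exp ((h * -t : ℝ) * Complex.I) • translate (√(h / 2) • -z) F, G⟫_ℂ =
    ⟪F, Complex.exp ((h * t : ℝ) * Complex.I) • translate (√(h / 2) • z) G⟫_ℂ
  rw [inner_smul_left, inner_smul_right, inner_translate_left, smul_neg, neg_neg,
    ← Complex.exp_conj]
  congr 2
  simp

theorem continuous_heisenbergRep {X : Type*} [TopologicalSpace X] (h : ℝ) {z : X → CSpace n}
    {t : X → ℝ} (hz : Continuous z) (ht : Continuous t) (F : FockSpace n) :
    Continuous fun x => heisenbergRep h (z x) (t x) F := by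
  change Continuous fun x => Complex.exp ((h * t x : ℝ) * Complex.I) •
    translate (√(h / 2) • z x) F
  have h1 : Continuous fun x => translate (√(h / 2) • z x) F :=
    (continuous_translate F).comp (by fun_prop : Continuous fun x => √(h / 2) • z x)
  fun_prop

end FockSpace

/-! ### Strong integrals of operators -/

section StrongIntegral

variable {H : Type*} [NormedAddCommGroup H] [InnerProductSpace ℂ H] {α : Type*}
  [MeasurableSpace α]

theorem integrable_of_strong {m : Measure α} [IsFiniteMeasure m] {T : α → H →L[ℂ] H}
    (hT : ∀ F, AEStronglyMeasurable (fun a => T a F) m) (hb : ∀ a, ‖T a‖ ≤ 1) (F : H) :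
    Integrable (fun a => T a F) m :=
  Integrable.of_bound (hT F) ‖F‖ (ae_of_all _ fun a =>
    (ContinuousLinearMap.le_of_opNorm_le _ (hb a) F).trans (by rw [one_mul]))

/-- The integral of a strongly measurable family of contractions over a finite measure, in the
strong sense: `(∫ T) F = ∫ T a F`, a Bochner integral in `H`. -/
def strongIntegral (m : Measure α) [IsFiniteMeasure m] (T : α → H →L[ℂ] H)
    (hT : ∀ F, AEStronglyMeasurable (fun a => T a F) m) (hb : ∀ a, ‖T a‖ ≤ 1) : H →L[ℂ] H :=
  LinearMap.mkContinuous
    { toFun := fun F => ∫ a, T a F ∂m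
      map_add' := fun F G => by
        simp only [map_add]
        exact integral_add (integrable_of_strong hT hb F) (integrable_of_strong hT hb G)
      map_smul' := fun c F => by
        simp only [map_smul, RingHom.id_apply]
        exact integral_smul c _ }
    (m.real Set.univ) (fun F => by
      refine (norm_integral_le_of_norm_le_const (C := ‖F‖) (ae_of_all _ fun a => ?_)).trans
        (le_of_eq (mul_comm _ _))
      exact (ContinuousLinearMap.le_of_opNorm_le _ (hb a) F).trans (by rw [one_mul]))

theorem strongIntegral_apply (m : Measure α) [IsFiniteMeasure m] (T : α → H →L[ℂ] H)
    (hT : ∀ F, AEStronglyMeasurable (fun a => T a F) m) (hb : ∀ a, ‖T a‖ ≤ 1) (F : H) :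
    strongIntegral m T hT hb F = ∫ a, T a F ∂m := rfl

theorem norm_strongIntegral_le (m : Measure α) [IsFiniteMeasure m] (T : α → H →L[ℂ] H)
    (hT : ∀ F, AEStronglyMeasurable (fun a => T a F) m) (hb : ∀ a, ‖T a‖ ≤ 1) :
    ‖strongIntegral m T hT hb‖ ≤ m.real Set.univ :=
  LinearMap.mkContinuous_norm_le _ measureReal_nonneg _

theorem adjoint_strongIntegral [CompleteSpace H] (m : Measure α) [IsFiniteMeasure m] (T T' : α → H →L[ℂ] H)
    (hT : ∀ F, AEStronglyMeasurable (fun a => T a F) m) (hb : ∀ a, ‖T a‖ ≤ 1)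
    (hT' : ∀ F, AEStronglyMeasurable (fun a => T' a F) m) (hb' : ∀ a, ‖T' a‖ ≤ 1)
    (h : ∀ a, ContinuousLinearMap.adjoint (T a) = T' a) :
    ContinuousLinearMap.adjoint (strongIntegral m T hT hb) = strongIntegral m T' hT' hb' := by
  symm
  rw [ContinuousLinearMap.eq_adjoint_iff]
  intro F G
  rw [strongIntegral_apply, strongIntegral_apply, ← integral_inner
    (integrable_of_strong hT hb G) F, ← inner_conj_symm, ← integral_inner
    (integrable_of_strong hT' hb' F) G, ← integral_conj]
  refine integral_congr_ae (ae_of_all _ fun a => ?_)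
  simp only [inner_conj_symm, ← h a, ContinuousLinearMap.adjoint_inner_left]

theorem continuous_strong_apply {X : Type*} [TopologicalSpace X] {T : X → H →L[ℂ] H} {f : X → H}
    (hb : ∀ x, ‖T x‖ ≤ 1) (hT : ∀ F, Continuous fun x => T x F) (hf : Continuous f) :
    Continuous fun x => T x (f x) := by
  refine continuous_iff_continuousAt.2 fun x₀ => ?_
  rw [ContinuousAt, tendsto_iff_norm_sub_tendsto_zero]
  have h1 : Tendsto (fun x => ‖f x - f x₀‖ + ‖T x (f x₀) - T x₀ (f x₀)‖) (𝓝 x₀) (𝓝 0) := by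
    have h2 := tendsto_iff_norm_sub_tendsto_zero.1 (hf.tendsto x₀)
    have h3 := tendsto_iff_norm_sub_tendsto_zero.1 ((hT (f x₀)).tendsto x₀)
    simpa using h2.add h3
  refine squeeze_zero (fun x => norm_nonneg _) (fun x => ?_) h1
  have h4 : T x (f x) - T x₀ (f x₀) = T x (f x - f x₀) + (T x (f x₀) - T x₀ (f x₀)) := by
    rw [map_sub]
    abel
  rw [h4]
  refine (norm_add_le _ _).trans ?_
  gcongr
  exact (ContinuousLinearMap.le_of_opNorm_le _ (hb x) _).trans (by rw [one_mul])

theorem continuous_strongIntegral {X : Type*} [TopologicalSpace X] [FirstCountableTopology X]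
    (m : Measure α) [IsFiniteMeasure m] (T : X → α → H →L[ℂ] H)
    (hT : ∀ x F, AEStronglyMeasurable (fun a => T x a F) m) (hb : ∀ x a, ‖T x a‖ ≤ 1)
    (hc : ∀ a F, Continuous fun x => T x a F) (F : H) :
    Continuous fun x => strongIntegral m (T x) (hT x) (hb x) F := by
  simp only [strongIntegral_apply]
  refine continuous_of_dominated (bound := fun _ => ‖F‖) (fun x => hT x F) (fun x => ?_)
    (integrable_const _) (ae_of_all _ fun a => hc a F)
  exact ae_of_all _ fun a =>
    (ContinuousLinearMap.le_of_opNorm_le _ (hb x a) F).trans (by rw [one_mul])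

end StrongIntegral

/-! ### H-type algebras -/

/-- The map `J_μ` of a bilinear map `[·, ·] : 𝔳 × 𝔳 → 𝔷`, determined by
`⟪J_μ x, y⟫ = ⟪μ, [x, y]⟫`. The dual spaces of `𝔳` and `𝔷` are identified with `𝔳` and `𝔷`
through the inner products. -/
def bracketJ {V Z : Type*} [NormedAddCommGroup V] [InnerProductSpace ℝ V] [FiniteDimensional ℝ V]
    [NormedAddCommGroup Z] [InnerProductSpace ℝ Z] [FiniteDimensional ℝ Z]
    (B : V →ₗ[ℝ] V →ₗ[ℝ] Z) (μ : Z) : V →L[ℝ] V :=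
  LinearMap.toContinuousLinearMap
    { toFun := fun x => LinearMap.adjoint (B x) μ
      map_add' := fun x y => by rw [map_add, map_add, LinearMap.add_apply]
      map_smul' := fun c x => by simp }

theorem inner_bracketJ {V Z : Type*} [NormedAddCommGroup V] [InnerProductSpace ℝ V]
    [FiniteDimensional ℝ V] [NormedAddCommGroup Z] [InnerProductSpace ℝ Z]
    [FiniteDimensional ℝ Z] (B : V →ₗ[ℝ] V →ₗ[ℝ] Z) (μ : Z) (x y : V) :
    ⟪bracketJ B μ x, y⟫_ℝ = ⟪μ, B x y⟫_ℝ :=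
  LinearMap.adjoint_inner_left (B x) y μ

/-- An H-type Lie algebra `𝔤 = 𝔳 ⊕ 𝔷` (orthogonal sum of finite dimensional Euclidean spaces):
the Lie bracket is an alternating bilinear map `𝔳 × 𝔳 → 𝔷`, `𝔷` is central, and
`J_μ² = -|μ|²` for all `μ`. (If `𝔳 ≠ 0`, the last condition makes `𝔷` the whole centre.) -/
structure HTypeAlgebra (V Z : Type*) [NormedAddCommGroup V] [InnerProductSpace ℝ V]
    [FiniteDimensional ℝ V] [NormedAddCommGroup Z] [InnerProductSpace ℝ Z]
    [FiniteDimensional ℝ Z] where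
  bracket : V →ₗ[ℝ] V →ₗ[ℝ] Z
  bracket_self : ∀ x, bracket x x = 0
  bracketJ_sq : ∀ (μ : Z) (x : V), bracketJ bracket μ (bracketJ bracket μ x) = -(‖μ‖ ^ 2 • x)

namespace HTypeAlgebra

variable {V Z : Type*} [NormedAddCommGroup V] [InnerProductSpace ℝ V] [FiniteDimensional ℝ V]
  [NormedAddCommGroup Z] [InnerProductSpace ℝ Z] [FiniteDimensional ℝ Z]
  (A : HTypeAlgebra V Z) {n : ℕ}

/-- `J_μ : 𝔳 → 𝔳`, `⟪J_μ x, y⟫ = ⟪μ, [x, y]⟫`. -/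
def J (μ : Z) : V →L[ℝ] V := bracketJ A.bracket μ

/-- A symplectic frame for `μ ≠ 0`: a linear isometry from `ℝ²ⁿ = ℂⁿ` onto `𝔳` which carries
multiplication by `i` to `J_μ / |μ|`. In particular `dim 𝔳 = 2n`. -/
structure Frame (μ : Z) (n : ℕ) where
  R : CSpace n ≃ₗᵢ[ℝ] V
  map_I_smul : ∀ z : CSpace n, A.J μ (R z) = ‖μ‖ • R (Complex.I • z)

variable {A}

/-- The representation `π_μ = π_{|μ|} ∘ α_μ`, `α_μ (x, u) = (R_μᵗ x, μ · u / |μ|)`, of the H-type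
group `G = 𝔳 × 𝔷` (in exponential coordinates) on Fock space. -/
def rep {μ : Z} (R : A.Frame μ n) (g : V × Z) : FockSpace n →L[ℂ] FockSpace n :=
  FockSpace.heisenbergRep ‖μ‖ (R.R.symm g.1) (⟪μ, g.2⟫_ℝ / ‖μ‖)

variable (A) in
/-- The helix `γ_{ν, λ} (s) = (exp (s J_λ) J_λ⁻¹ ν, s |ν|² λ / (2 |λ|²))`, a geodesic of charge
`λ ≠ 0`. (For `λ ≠ 0` the operator `J_λ` is invertible, so that `Ring.inverse` is its inverse.) -/
def helix (ν : V) (l : Z) (s : ℝ) : V × Z :=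
  (NormedSpace.exp (s • A.J l) (Ring.inverse (A.J l) ν),
    (s * ‖ν‖ ^ 2 / (2 * ‖l‖ ^ 2)) • l)

theorem norm_rep_le {μ : Z} (R : A.Frame μ n) (g : V × Z) : ‖rep R g‖ ≤ 1 :=
  FockSpace.norm_heisenbergRep_le _ _ _

theorem adjoint_rep {μ : Z} (R : A.Frame μ n) (g : V × Z) :
    ContinuousLinearMap.adjoint (rep R g) = rep R (-g) := by
  rw [rep, FockSpace.adjoint_heisenbergRep, rep, Prod.fst_neg, Prod.snd_neg, map_neg,
    inner_neg_right, neg_div]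

theorem continuous_rep {X : Type*} [TopologicalSpace X] {μ : Z} (R : A.Frame μ n) {g : X → V × Z}
    (hg : Continuous g) (F : FockSpace n) : Continuous fun x => rep R (g x) F := by
  apply FockSpace.continuous_heisenbergRep
  · exact R.R.symm.continuous.comp hg.fst
  · have := hg.snd
    fun_prop

variable (A) in
theorem continuous_helix (l : Z) : Continuous fun p : V × ℝ => A.helix p.1 l p.2 := by
  let _ : NormedAlgebra ℚ (V →L[ℝ] V) := NormedAlgebra.restrictScalars ℚ ℝ (V →L[ℝ] V)
  have h1 : Continuous fun p : V × ℝ => NormedSpace.exp (p.2 • A.J l) :=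
    NormedSpace.exp_continuous.comp (by fun_prop)
  unfold helix
  fun_prop

theorem continuous_rep_helix {μ : Z} (R : A.Frame μ n) (ν : V) (l : Z) (F : FockSpace n) :
    Continuous fun s : ℝ => rep R (A.helix ν l s) F :=
  continuous_rep R ((A.continuous_helix l).comp (by fun_prop : Continuous fun s : ℝ => (ν, s))) F

theorem continuous_rep_helix_neg {μ : Z} (R : A.Frame μ n) (ν : V) (l : Z) (F : FockSpace n) :
    Continuous fun s : ℝ => rep R (-A.helix ν l s) F :=
  continuous_rep R
    ((A.continuous_helix l).comp (by fun_prop : Continuous fun s : ℝ => (ν, s))).neg F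

/-- The operator valued Bessel function
`𝓙_{ν, λ} (μ) = |λ| / (2π) ∫₀^{2π/|λ|} π_μ (γ_{ν, λ} (s)) ds`. -/
def multiplier {μ : Z} (R : A.Frame μ n) (ν : V) (l : Z) : FockSpace n →L[ℂ] FockSpace n :=
  ((‖l‖ / (2 * Real.pi) : ℝ) : ℂ) •
    strongIntegral (volume.restrict (Set.Ioc 0 (2 * Real.pi / ‖l‖)))
      (fun s => rep R (A.helix ν l s))
      (fun F => (continuous_rep_helix R ν l F).aestronglyMeasurable) (fun _ => norm_rep_le R _)

/-- The normal operator `𝓝_{ν, λ} (μ) = 𝓙_{ν, λ} (μ)* 𝓙_{ν, λ} (μ)`. -/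
def normalOp {μ : Z} (R : A.Frame μ n) (ν : V) (l : Z) : FockSpace n →L[ℂ] FockSpace n :=
  ContinuousLinearMap.adjoint (multiplier R ν l) ∘L multiplier R ν l

theorem norm_multiplier_le {μ : Z} (R : A.Frame μ n) (ν : V) (l : Z) :
    ‖multiplier R ν l‖ ≤ 1 := by
  have hpi := Real.pi_pos
  rw [multiplier, norm_smul, Complex.norm_real, Real.norm_of_nonneg (by positivity)]
  refine (mul_le_mul_of_nonneg_left (norm_strongIntegral_le _ _ _ _) (by positivity)).trans ?_
  rw [measureReal_restrict_apply MeasurableSet.univ, Set.univ_inter, Real.volume_real_Ioc,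
    sub_zero, max_eq_left (by positivity)]
  rcases eq_or_ne ‖l‖ 0 with h | h
  · simp [h]
  · apply le_of_eq
    field_simp

theorem norm_normalOp_le {μ : Z} (R : A.Frame μ n) (ν : V) (l : Z) : ‖normalOp R ν l‖ ≤ 1 := by
  refine (ContinuousLinearMap.opNorm_comp_le _ _).trans ?_
  rw [LinearIsometryEquiv.norm_map]
  exact mul_le_one₀ (norm_multiplier_le R ν l) (norm_nonneg _) (norm_multiplier_le R ν l)

theorem continuous_normalOp {μ : Z} (R : A.Frame μ n) (l : Z) (F : FockSpace n) :
    Continuous fun ν => normalOp R ν l F := by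
  have h1 : Continuous fun ν => multiplier R ν l F := by
    have h := continuous_strongIntegral (volume.restrict (Set.Ioc 0 (2 * Real.pi / ‖l‖)))
      (fun ν s => rep R (A.helix ν l s))
      (fun ν F => (continuous_rep_helix R ν l F).aestronglyMeasurable)
      (fun _ _ => norm_rep_le R _) (fun s G => continuous_rep R ((A.continuous_helix l).comp
        (by fun_prop : Continuous fun ν : V => (ν, s))) G) F
    have h3 := h.const_smul ((‖l‖ / (2 * Real.pi) : ℝ) : ℂ)
    exact h3
  refine continuous_strong_apply (T := fun ν => ContinuousLinearMap.adjoint (multiplier R ν l))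
    (fun ν => ?_) (fun G => ?_) h1
  · rw [LinearIsometryEquiv.norm_map]
    exact norm_multiplier_le R ν l
  · have h2 : ∀ ν, ContinuousLinearMap.adjoint (multiplier R ν l) =
        ((‖l‖ / (2 * Real.pi) : ℝ) : ℂ) •
          strongIntegral (volume.restrict (Set.Ioc 0 (2 * Real.pi / ‖l‖)))
            (fun s => rep R (-A.helix ν l s))
            (fun F => (continuous_rep_helix_neg R ν l F).aestronglyMeasurable)
            (fun _ => norm_rep_le R _) := by
      intro ν
      rw [multiplier, LinearIsometryEquiv.map_smulₛₗ, Complex.conj_ofReal]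
      congr 1
      exact adjoint_strongIntegral _ _ _ _ _ _ _ fun s => adjoint_rep R _
    simp only [h2]
    have h := continuous_strongIntegral (volume.restrict (Set.Ioc 0 (2 * Real.pi / ‖l‖)))
      (fun ν s => rep R (-A.helix ν l s))
      (fun ν F => (continuous_rep_helix_neg R ν l F).aestronglyMeasurable)
      (fun _ _ => norm_rep_le R _) (fun s G => continuous_rep R ((A.continuous_helix l).comp
        (by fun_prop : Continuous fun ν : V => (ν, s))).neg G) G
    have h3 := h.const_smul ((‖l‖ / (2 * Real.pi) : ℝ) : ℂ)
    exact h3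

/-! ### The averaged normal operator -/

variable (A) in
/-- `U(λ)`: the orthogonal transformations of `𝔳` which commute with `J_λ`. -/
def unitarySubgroup (l : Z) : Subgroup (unitary (V →L[ℝ] V)) where
  carrier := {U | (U : V →L[ℝ] V) * A.J l = A.J l * (U : V →L[ℝ] V)}
  one_mem' := by simp
  mul_mem' := fun {U W} hU hW => by
    simp only [Set.mem_ofPred_eq, Submonoid.coe_mul] at hU hW ⊢
    rw [mul_assoc, hW, ← mul_assoc, hU, mul_assoc]
  inv_mem' := fun {U} hU => by
    have h1 : ((U⁻¹ : unitary (V →L[ℝ] V)) : V →L[ℝ] V) * (U : V →L[ℝ] V) = 1 := by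
      rw [← Submonoid.coe_mul, inv_mul_cancel, Submonoid.coe_one]
    have h2 : (U : V →L[ℝ] V) * ((U⁻¹ : unitary (V →L[ℝ] V)) : V →L[ℝ] V) = 1 := by
      rw [← Submonoid.coe_mul, mul_inv_cancel, Submonoid.coe_one]
    simp only [Set.mem_ofPred_eq] at hU ⊢
    calc _ = ((U⁻¹ : unitary (V →L[ℝ] V)) : V →L[ℝ] V) * (A.J l * (U : V →L[ℝ] V)) *
          ((U⁻¹ : unitary (V →L[ℝ] V)) : V →L[ℝ] V) := by
          rw [mul_assoc, mul_assoc, h2, mul_one]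
      _ = _ := by rw [← hU, ← mul_assoc, h1, one_mul]

instance (l : Z) : CompactSpace (A.unitarySubgroup l) := by
  let f : A.unitarySubgroup l → (V →L[ℝ] V) := fun U => ((U : unitary (V →L[ℝ] V)) : V →L[ℝ] V)
  have hf : Topology.IsEmbedding f :=
    Topology.IsEmbedding.subtypeVal.comp Topology.IsEmbedding.subtypeVal
  have hrange : Set.range f =
      {U | star U * U = 1} ∩ {U | U * star U = 1} ∩ {U | U * A.J l = A.J l * U} := by
    ext U
    constructor
    · rintro ⟨W, rfl⟩
      exact ⟨W.1.2, W.2⟩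
    · rintro ⟨hU, hUJ⟩
      exact ⟨⟨⟨U, hU⟩, hUJ⟩, rfl⟩
  rw [← isCompact_univ_iff, hf.isCompact_iff, Set.image_univ, hrange]
  refine Metric.isCompact_of_isClosed_isBounded ?_ ?_
  · refine IsClosed.inter (IsClosed.inter ?_ ?_) ?_
    · exact isClosed_eq (by fun_prop) continuous_const
    · exact isClosed_eq (by fun_prop) continuous_const
    · exact isClosed_eq (by fun_prop) (by fun_prop)
  · refine (Metric.isBounded_closedBall (x := 0) (r := 1)).subset ?_
    rintro U ⟨hU, -⟩
    rw [mem_closedBall_zero_iff]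
    refine ContinuousLinearMap.opNorm_le_bound _ zero_le_one fun x => ?_
    rw [one_mul]
    apply le_of_eq
    exact ContinuousLinearMap.norm_map_of_mem_unitary (Unitary.mem_iff.2 hU) x

instance (l : Z) : MeasurableSpace (A.unitarySubgroup l) := borel _

instance (l : Z) : BorelSpace (A.unitarySubgroup l) := ⟨rfl⟩

variable (A) in
/-- The normalized Haar measure of the compact group `U(λ)`. -/
def unitaryHaar (l : Z) : Measure (A.unitarySubgroup l) := Measure.haarMeasure ⊤

instance (l : Z) : IsProbabilityMeasure (A.unitaryHaar l) :=
  ⟨Measure.haarMeasure_self (K₀ := (⊤ : TopologicalSpace.PositiveCompacts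
    (A.unitarySubgroup l)))⟩

/-- The averaged normal operator `𝓝_λ (μ) = ∫_{U(λ)} 𝓝_{Uν, λ} (μ) dU`. -/
def averagedNormalOp {μ : Z} (R : A.Frame μ n) (ν : V) (l : Z) : FockSpace n →L[ℂ] FockSpace n :=
  strongIntegral (A.unitaryHaar l) (fun U => normalOp R ((U : V →L[ℝ] V) ν) l)
    (fun F => ((continuous_normalOp R l F).comp (by fun_prop :
      Continuous fun U : A.unitarySubgroup l => (U : V →L[ℝ] V) ν)).aestronglyMeasurable)
    (fun _ => norm_normalOp_le R _ l)

end HTypeAlgebra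

/-- Invertibility of a bounded self-adjoint operator on a Hilbert space in the sense that zero is
not an eigenvalue: the operator is injective with dense range, and its inverse is a densely defined
operator (which may be unbounded). -/
def HasDenselyDefinedInverse {H : Type*} [NormedAddCommGroup H] [InnerProductSpace ℂ H]
    (T : H →L[ℂ] H) : Prop :=
  Function.Injective T ∧ DenseRange T

end

/-! The operator is self-adjoint, so injectivity already gives dense range. Pairing the averaged
operator with F gives the integral of ‖𝓙_{Uν,λ}(μ)F‖² over U(λ). A continuous non-negative function
with zero Haar integral vanishes, and U(λ) is transitive on the unit sphere of 𝔳, so an F in the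
kernel is annihilated by 𝓙_{x,λ}(μ) for every unit x. In a frame, J_λ/|λ| becomes an orthogonal
complex structure j on ℂⁿ. The claim is then that ∫ e^{ikθ} T(e^{θj}w)F dθ = 0 for all |w| = r
forces F = 0, where T is the projective representation by translations
(`FockSpace.eq_zero_of_orbitMean`).

In general j does not commute with multiplication by i, so a single equation is not invariant under
the rotations F ↦ F(c·), |c| = 1. The joint kernel is nevertheless invariant
(`FockSpace.orbitMean_rotate_eq_zero`). Indeed, the square norm of the orbit mean expands into terms
⟪F, T(e^{θj}w - e^{φj}w)F⟫ times a phase. The H-type relation ⟪J_λ x, J_μ x⟫ = ⟪λ, μ⟫|x|² makes the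
phase depend only on θ, φ and |w|, and the difference vector is a real multiple of an isometric
image of w. After averaging over the sphere the isometry disappears, and so does the effect of a
rotation. Hence each homogeneous component of F solves the same equations, and F may be taken
homogeneous of degree p.

For homogeneous F the equations are evaluated at large points. Let κ be minus the cosine of the
angle between μ and λ, so that Im⟪jx, x⟫ = κ|x|². If κ² ≠ 1, some w has jw ⊥ ζ but not w ⊥ ζ; the
exponential weight becomes e^{-N cos θ}, and Laplace's method isolates F(ζ). If κ² = 1, then j = ±i
and r² = |k| is a positive integer K. When n > 1, a w ⊥ ζ and a limit leave F(ζ) times a non-zero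
Fourier coefficient. When n = 1, the value of the equation at w itself is F(w) times a multiple of
the Laguerre value L_p^{(K)}(K), which is non-zero by parity for odd K. -/

noncomputable section

/-! ### Homogeneous components of entire functions. -/

open scoped Nat in
/-- Cauchy's formula: the Fourier coefficients of an entire function on the unit circle are its
Taylor coefficients. -/
theorem integral_exp_mul_eq_iteratedDeriv {f : ℂ → ℂ} (hf : Differentiable ℂ f) (p : ℕ) :
    ∫ α in (0 : ℝ)..2 * Real.pi, Complex.exp (-(p * α * Complex.I)) *
      f (Complex.exp (α * Complex.I)) =
      2 * Real.pi * ((p ! : ℂ)⁻¹ * iteratedDeriv p f 0) := by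
  have h := (hf.differentiableOn (s := Metric.closedBall 0 1)).circleIntegral_one_div_sub_center_pow_smul
    one_pos p
  rw [circleIntegral] at h
  have h2 : ∀ α : ℝ, deriv (circleMap 0 1) α • (1 / (circleMap 0 1 α - 0) ^ (p + 1)) •
      f (circleMap 0 1 α) = Complex.I * (Complex.exp (-(p * α * Complex.I)) *
      f (Complex.exp (α * Complex.I))) := by
    intro α
    have he : Complex.exp (α * Complex.I) ≠ 0 := Complex.exp_ne_zero _
    have h3 : Complex.exp (-(p * α * Complex.I)) = (Complex.exp (α * Complex.I) ^ p)⁻¹ := by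
      rw [← Complex.exp_nat_mul, ← Complex.exp_neg]
      ring_nf
    simp only [deriv_circleMap, circleMap, Complex.ofReal_one, one_mul, zero_add, sub_zero,
      smul_eq_mul, h3]
    field_simp
    ring
  simp only [h2] at h
  rw [intervalIntegral.integral_const_mul] at h
  have h4 : (Complex.I : ℂ) ≠ 0 := Complex.I_ne_zero
  apply mul_left_cancel₀ h4
  rw [h, smul_eq_mul]
  ring

/-- The homogeneous component of degree `p` (times `2π`) of an entire function. -/
def homogPart {n : ℕ} (p : ℕ) (F : CSpace n → ℂ) (ζ : CSpace n) : ℂ :=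
  ∫ α in (0 : ℝ)..2 * Real.pi, Complex.exp (-(p * α * Complex.I)) *
    F (Complex.exp (α * Complex.I) • ζ)

open scoped Nat in
theorem homogPart_eq {n : ℕ} {F : CSpace n → ℂ} (hF : Differentiable ℂ F) (p : ℕ)
    (ζ : CSpace n) : homogPart p F ζ =
      2 * Real.pi * ((p ! : ℂ)⁻¹ * iteratedDeriv p (fun t : ℂ => F (t • ζ)) 0) :=
  integral_exp_mul_eq_iteratedDeriv (f := fun t : ℂ => F (t • ζ))
    (hF.comp (differentiable_id.smul_const ζ)) p

/-- The integral itself only shows the case |t| = 1. Cauchy's formula identifies it with a Taylor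
coefficient, which scales correctly for every complex t; later arguments need large t. -/
theorem homogPart_smul {n : ℕ} {F : CSpace n → ℂ} (hF : Differentiable ℂ F) (p : ℕ) (t : ℂ)
    (ζ : CSpace n) : homogPart p F (t • ζ) = t ^ p * homogPart p F ζ := by
  have h0 : Differentiable ℂ (fun s : ℂ => F (s • ζ)) := hF.comp (differentiable_id.smul_const ζ)
  have h := iteratedDeriv_comp_const_mul (n := p) h0.contDiff t
  rw [homogPart_eq hF, homogPart_eq hF]
  have h1 : (fun s : ℂ => F (s • t • ζ)) = fun s : ℂ => F ((t * s) • ζ) := by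
    funext s
    rw [smul_smul, mul_comm]
  rw [h1, h]
  simp only [mul_zero]
  ring

/-- F(ζ) is the sum at t = 1 of the Taylor series of t ↦ F(tζ), whose terms are the components up to
the factor 2π. -/
theorem eq_zero_of_homogPart_eq_zero {n : ℕ} {F : CSpace n → ℂ} (hF : Differentiable ℂ F)
    {ζ : CSpace n} (h : ∀ p, homogPart p F ζ = 0) : F ζ = 0 := by
  have h0 : Differentiable ℂ (fun s : ℂ => F (s • ζ)) := hF.comp (differentiable_id.smul_const ζ)
  have h1 := Complex.taylorSeries_eq_of_entire' 0 1 h0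
  rw [one_smul] at h1
  rw [← h1]
  refine (tsum_congr fun p => ?_).trans tsum_zero
  have h2 := h p
  rw [homogPart_eq hF, mul_eq_zero] at h2
  rcases h2 with h2 | h2
  · have : (2 * Real.pi : ℂ) ≠ 0 := by exact_mod_cast Real.two_pi_pos.ne'
    exact absurd h2 this
  · rw [h2, zero_mul]

theorem continuous_homogPart {n : ℕ} {F : CSpace n → ℂ} (hF : Continuous F) (p : ℕ) :
    Continuous (homogPart p F) := by
  unfold homogPart
  apply intervalIntegral.continuous_parametric_intervalIntegral_of_continuous'
  unfold Function.uncurry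
  fun_prop

/-! ### Fourier coefficients of exponentials -/

theorem integral_two_pi_sub (f : ℝ → ℂ) :
    ∫ θ in (0 : ℝ)..2 * Real.pi, f (2 * Real.pi - θ) = ∫ θ in (0 : ℝ)..2 * Real.pi, f θ := by
  simp

/-- Used with `integral_two_pi_sub` to reverse the circle: Cauchy's formula pairs e^{-ipα} with
f(e^{iα}), while the twisted means carry the opposite signs. -/
theorem exp_two_pi_sub_mul_I (m : ℤ) (θ : ℝ) :
    Complex.exp (m * (2 * Real.pi - θ : ℝ) * Complex.I) = Complex.exp (-(m * θ * Complex.I)) := by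
  have : (m * (2 * Real.pi - θ : ℝ) * Complex.I : ℂ) =
      -(m * θ * Complex.I) + m * (2 * Real.pi * Complex.I) := by
    push_cast
    ring
  rw [this, Complex.exp_add, Complex.exp_int_mul_two_pi_mul_I, mul_one]

-- Up to the factor 2π this is the m-th Taylor coefficient of z ↦ e^{cz}, read on the reversed
-- circle.
open scoped Nat in
theorem integral_exp_mul_exp_exp (c : ℂ) (m : ℕ) :
    ∫ θ in (0 : ℝ)..2 * Real.pi, Complex.exp (m * θ * Complex.I) *
      Complex.exp (c * Complex.exp (-(θ * Complex.I))) = 2 * Real.pi * (c ^ m / (m ! : ℂ)) := by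
  have h := integral_exp_mul_eq_iteratedDeriv (f := fun z => Complex.exp (c * z)) (by fun_prop) m
  rw [← integral_two_pi_sub] at h
  have h1 := fun θ : ℝ => exp_two_pi_sub_mul_I (-(m : ℤ)) θ
  have h2 := fun θ : ℝ => exp_two_pi_sub_mul_I 1 θ
  simp only [Int.cast_neg, Int.cast_natCast, Int.cast_one, one_mul, neg_mul, neg_neg] at h1 h2
  simp only [h1, h2] at h
  rw [h, iteratedDeriv_comp_const_mul Complex.contDiff_exp, iteratedDeriv_eq_iterate,
    Complex.iter_deriv_exp]
  simp only [mul_zero, Complex.exp_zero]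
  field_simp

open scoped Nat in
theorem integral_exp_mul_exp_exp_mul_pow (K : ℕ) (c : ℂ) (p : ℕ) :
    ∫ θ in (0 : ℝ)..2 * Real.pi, Complex.exp (K * θ * Complex.I) *
      (Complex.exp (c * Complex.exp (-(θ * Complex.I))) * (1 + Complex.exp (θ * Complex.I)) ^ p) =
      2 * Real.pi * ∑ i ∈ Finset.range (p + 1), (p.choose i : ℂ) * (c ^ (K + i) / ((K + i)! : ℂ)) := by
  have h : ∀ θ : ℝ, Complex.exp (K * θ * Complex.I) *
      (Complex.exp (c * Complex.exp (-(θ * Complex.I))) * (1 + Complex.exp (θ * Complex.I)) ^ p) =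
      ∑ i ∈ Finset.range (p + 1), (p.choose i : ℂ) * (Complex.exp ((K + i : ℕ) * θ * Complex.I) *
        Complex.exp (c * Complex.exp (-(θ * Complex.I)))) := by
    intro θ
    rw [add_comm (1 : ℂ), add_pow, Finset.mul_sum, Finset.mul_sum]
    refine Finset.sum_congr rfl fun i _ => ?_
    rw [one_pow, mul_one, ← Complex.exp_nat_mul]
    have : Complex.exp ((K + i : ℕ) * θ * Complex.I) =
        Complex.exp (K * θ * Complex.I) * Complex.exp (i * (θ * Complex.I)) := by
      rw [← Complex.exp_add]
      push_cast
      ring_nf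
    rw [this]
    ring
  simp only [h]
  rw [intervalIntegral.integral_finsetSum]
  · rw [Finset.mul_sum]
    refine Finset.sum_congr rfl fun i _ => ?_
    rw [intervalIntegral.integral_const_mul, integral_exp_mul_exp_exp]
    ring
  · intro i _
    apply Continuous.intervalIntegrable
    fun_prop

/-- The Laguerre polynomial `L_p^{(K)}` does not vanish at `K` if `K` is odd. -/
theorem sum_choose_mul_pow_div_factorial_ne_zero {K : ℕ} (hK : Odd K) (p : ℕ) :
    ∑ i ∈ Finset.range (p + 1), (p.choose i : ℂ) * ((-K : ℂ) ^ (K + i) / ((K + i).factorial : ℂ)) ≠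
      0 := by
  intro h0
  -- Taking out (-K)^K / (K+p)! leaves a sum of integers, because (K+p)!/(K+i)! is a falling
  -- factorial. The integer sum is then shown to be odd.
  have hterm : ∀ i ∈ Finset.range (p + 1),
      (p.choose i : ℂ) * ((-K : ℂ) ^ (K + i) / ((K + i).factorial : ℂ)) =
      (-K : ℂ) ^ K / ((K + p).factorial : ℂ) *
        (((p.choose i : ℤ) * (-(K : ℤ)) ^ i * ((K + p).descFactorial (p - i) : ℕ) : ℤ) : ℂ) := by
    intro i hi
    have hip : i ≤ p := Nat.lt_succ_iff.1 (Finset.mem_range.1 hi)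
    have h1 : (K + i).factorial * (K + p).descFactorial (p - i) = (K + p).factorial := by
      have := Nat.factorial_mul_descFactorial (n := K + p) (k := p - i) (by omega)
      rwa [show K + p - (p - i) = K + i by omega] at this
    have h2 : ((K + p).factorial : ℂ) =
        ((K + i).factorial : ℂ) * ((K + p).descFactorial (p - i) : ℂ) := by
      rw [← h1]; push_cast; rfl
    have h3 : ((K + i).factorial : ℂ) ≠ 0 := by exact_mod_cast (Nat.factorial_ne_zero _)
    have h4 : ((K + p).descFactorial (p - i) : ℂ) ≠ 0 := by
      rw [Nat.cast_ne_zero, Ne, Nat.descFactorial_eq_zero_iff_lt]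
      omega
    rw [h2]
    push_cast
    field_simp
    ring
  rw [Finset.sum_congr rfl hterm, ← Finset.mul_sum, mul_eq_zero] at h0
  have hK0 : (K : ℂ) ≠ 0 := by exact_mod_cast hK.pos.ne'
  rcases h0 with h0 | h0
  · refine div_ne_zero (pow_ne_zero _ (neg_ne_zero.2 hK0)) ?_ h0
    exact_mod_cast (Nat.factorial_ne_zero _)
  rw [← Int.cast_sum, Int.cast_eq_zero] at h0
  have h2 := congrArg (Int.cast : ℤ → ZMod 2) h0
  have hK2 : (K : ZMod 2) = 1 := by
    rw [← Nat.cast_one, ZMod.natCast_eq_natCast_iff]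
    exact Nat.odd_iff.1 hK
  -- The last term, i = p, is (-K)^p and hence odd; all the others are even.
  rw [Finset.sum_range_succ] at h2
  push_cast at h2
  rw [Finset.sum_eq_zero, zero_add, hK2] at h2
  · simp at h2
  intro i hi
  have hip : i < p := Finset.mem_range.1 hi
  -- A falling factorial of length p - i ≥ 2 is divisible by 2!. For p - i = 1 the product is p(K +
  -- p), even because K is odd.
  have heven : Even (p.choose i * (K + p).descFactorial (p - i)) := by
    rcases Nat.lt_or_ge (p - i) 2 with hlt | hge
    · have : i = p - 1 := by omega
      subst this
      have hp1 : p - (p - 1) = 1 := by omega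
      have hc : p.choose (p - 1) = p := by
        rw [Nat.choose_symm (by omega), Nat.choose_one_right]
      rw [hp1, hc, Nat.descFactorial_one, Nat.even_mul, Nat.even_add]
      have := Nat.not_even_iff_odd.2 hK
      tauto
    · refine Even.mul_left ?_ _
      have h2d : (2).factorial ∣ (p - i).factorial := Nat.factorial_dvd_factorial hge
      exact even_iff_two_dvd.2 (h2d.trans (Nat.factorial_dvd_descFactorial _ _))
  have h5 : ((p.choose i * (K + p).descFactorial (p - i) : ℕ) : ZMod 2) = 0 :=
    (ZMod.natCast_eq_zero_iff _ _).2 (even_iff_two_dvd.1 heven)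
  push_cast at h5
  linear_combination (-(K : ZMod 2)) ^ i * h5

/-! ### Twisted mean value equations for homogeneous functions. -/

section TwistedMean

variable {n : ℕ}

theorem inner_ofReal_smul_left (a : ℝ) (w ζ : CSpace n) : ⟪a • w, ζ⟫_ℂ = a * ⟪w, ζ⟫_ℂ := by
  rw [← Complex.coe_smul, inner_smul_left, Complex.conj_ofReal]

theorem inner_ofReal_smul_right (a : ℝ) (w ζ : CSpace n) : ⟪w, a • ζ⟫_ℂ = a * ⟪w, ζ⟫_ℂ := by
  rw [← Complex.coe_smul, inner_smul_right]

theorem inner_self_eq_of_norm_sq {w : CSpace n} {K : ℕ} (hw : ‖w‖ ^ 2 = K) : ⟪w, w⟫_ℂ = K := by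
  rw [inner_self_eq_norm_sq_to_K]
  have := congrArg Complex.ofReal hw
  push_cast at this
  exact this

/-- The orbit `θ ↦ exp (θ j) w` of a complex structure `j`. -/
def circleOrbit (j : CSpace n →ₗᵢ[ℝ] CSpace n) (θ : ℝ) (w : CSpace n) : CSpace n :=
  Real.cos θ • w + Real.sin θ • j w

theorem continuous_circleOrbit (j : CSpace n →ₗᵢ[ℝ] CSpace n) :
    Continuous fun p : ℝ × CSpace n => circleOrbit j p.1 p.2 := by
  unfold circleOrbit
  have := j.continuous
  fun_prop

theorem norm_circleOrbit_le (j : CSpace n →ₗᵢ[ℝ] CSpace n) (θ : ℝ) (w : CSpace n) :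
    ‖circleOrbit j θ w‖ ≤ 2 * ‖w‖ := by
  refine (norm_add_le _ _).trans ?_
  rw [norm_smul, norm_smul, j.norm_map, Real.norm_eq_abs, Real.norm_eq_abs]
  nlinarith [Real.abs_cos_le_one θ, Real.abs_sin_le_one θ, norm_nonneg w]

theorem inner_circleOrbit_left (j : CSpace n →ₗᵢ[ℝ] CSpace n) (θ : ℝ) (w ζ : CSpace n) :
    ⟪circleOrbit j θ w, ζ⟫_ℂ = Real.cos θ * ⟪w, ζ⟫_ℂ + Real.sin θ * ⟪j w, ζ⟫_ℂ := by
  rw [circleOrbit, inner_add_left, inner_ofReal_smul_left, inner_ofReal_smul_left]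

/-- Up to a factor, the value at `ζ` of the operator valued Bessel function applied to `F`. -/
def twistedMean (j : CSpace n →ₗᵢ[ℝ] CSpace n) (k : ℤ) (w : CSpace n) (F : CSpace n → ℂ)
    (ζ : CSpace n) : ℂ :=
  ∫ θ in (0 : ℝ)..2 * Real.pi, Complex.exp (k * θ * Complex.I) *
    (Complex.exp (-⟪circleOrbit j θ w, ζ⟫_ℂ) * F (ζ + circleOrbit j θ w))

theorem exp_neg_cos_lt {y : ℝ} (h0 : 0 ≤ y) (h1 : y ≤ 2 * Real.pi) (h : y ≠ Real.pi) :
    Real.exp (-Real.cos y) < Real.exp (-Real.cos Real.pi) := by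
  apply Real.exp_lt_exp.2
  have h2 : Real.cos y = -Real.cos (y - Real.pi) := by rw [Real.cos_sub_pi, neg_neg]
  have h3 : Real.cos (y - Real.pi) ≠ 1 := by
    intro h4
    have := (Real.cos_eq_one_iff_of_lt_of_lt (by linarith [Real.pi_pos])
      (by linarith [Real.pi_pos])).1 h4
    exact h (by linarith)
  have h5 := lt_of_le_of_ne (Real.cos_le_one (y - Real.pi)) h3
  rw [h2, Real.cos_pi]
  linarith

/-- Laplace's method. -/
theorem tendsto_integral_exp_neg_cos {g : ℕ → ℝ → ℂ} {k : ℤ} {c : ℂ}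
    (hg : ∀ N, Continuous (g N)) (hgc : ∀ ε > 0, ∀ᶠ N in atTop, ∀ θ, ‖g N θ - c‖ ≤ ε)
    (h0 : ∀ N : ℕ, 0 < N → ∫ θ in (0 : ℝ)..2 * Real.pi, Complex.exp (k * θ * Complex.I) *
      (Complex.exp (-(N * Real.cos θ)) * g N θ) = 0) : c = 0 := by
  set s : Set ℝ := Set.Icc 0 (2 * Real.pi) with hs
  set e : ℝ → ℝ := fun θ => Real.exp (-Real.cos θ) with he
  have hec : Continuous e := by fun_prop
  -- The weight e^{-N cos θ} is the N-th power of e, whose only maximum on [0, 2π] is at θ = π. The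
  -- normalized integrals therefore tend to e^{ikπ} c.
  have hpeak := tendsto_setIntegral_pow_smul_of_unique_maximum_of_isCompact_of_continuousOn
    (μ := volume) (s := s) (c := e) (x₀ := Real.pi)
    (g := fun θ : ℝ => Complex.exp (k * θ * Complex.I) * c) isCompact_Icc hec.continuousOn
    (fun y hy hne => exp_neg_cos_lt hy.1 hy.2 hne) (fun y _ => (Real.exp_pos _).le)
    (Real.exp_pos _) (by
      rw [hs, interior_Icc, closure_Ioo (by positivity)]
      exact ⟨Real.pi_pos.le, by linarith [Real.pi_pos]⟩) (by fun_prop)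
  have hZ : ∀ N : ℕ, 0 < ∫ θ in s, e θ ^ N := by
    intro N
    refine setIntegral_pos_iff_support_of_nonneg_ae ?_ ?_ |>.2 ?_
    · exact ae_of_all _ fun θ => (pow_pos (Real.exp_pos _) _).le
    · exact (hec.pow N).continuousOn.integrableOn_compact isCompact_Icc
    · have : Function.support (fun θ => e θ ^ N) = Set.univ := by
        ext θ
        simp [e, (Real.exp_pos _).ne']
      rw [this, Set.univ_inter, hs, Real.volume_Icc]
      simpa using Real.pi_pos
  have hzero : Tendsto (fun N : ℕ => (∫ θ in s, e θ ^ N)⁻¹ •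
      ∫ θ in s, e θ ^ N • (Complex.exp (k * θ * Complex.I) * c)) atTop (𝓝 0) := by
    rw [Metric.tendsto_nhds]
    intro ε hε
    filter_upwards [hgc (ε / 2) (by positivity), eventually_gt_atTop 0] with N hN hN0
    have h1 : ∫ θ in s, e θ ^ N • (Complex.exp (k * θ * Complex.I) * g N θ) = 0 := by
      rw [← h0 N hN0, intervalIntegral.integral_of_le (by positivity), hs,
        integral_Icc_eq_integral_Ioc]
      refine integral_congr_ae (ae_of_all _ fun θ => ?_)
      have h2 : ((e θ ^ N : ℝ) : ℂ) = Complex.exp (-(N * Real.cos θ)) := by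
        simp only [e, ← Real.exp_nat_mul]
        push_cast
        ring_nf
      simp only [Complex.real_smul, h2]
      ring
    have hi : ∀ {f : ℝ → ℂ}, Continuous f → IntegrableOn
        (fun θ => e θ ^ N • (Complex.exp (k * θ * Complex.I) * f θ)) s := fun hf =>
      Continuous.continuousOn (by fun_prop) |>.integrableOn_compact isCompact_Icc
    -- Since the integral against g N vanishes, the one against c equals the error term, which is
    -- uniformly small relative to the total weight.
    have h3 : ∫ θ in s, e θ ^ N • (Complex.exp (k * θ * Complex.I) * c) =
        -∫ θ in s, e θ ^ N • (Complex.exp (k * θ * Complex.I) * (g N θ - c)) := by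
      have h4 : ∀ θ, e θ ^ N • (Complex.exp (k * θ * Complex.I) * (g N θ - c)) =
          e θ ^ N • (Complex.exp (k * θ * Complex.I) * g N θ) -
          e θ ^ N • (Complex.exp (k * θ * Complex.I) * c) := fun θ => by
        rw [mul_sub, smul_sub]
      simp only [h4]
      rw [integral_sub (hi (hg N)) (hi continuous_const), h1, zero_sub, neg_neg]
    rw [dist_zero_right, h3, smul_neg, norm_neg, norm_smul, norm_inv,
      Real.norm_of_nonneg (hZ N).le, inv_mul_lt_iff₀ (hZ N)]
    have h5 : ‖∫ θ in s, e θ ^ N • (Complex.exp (k * θ * Complex.I) * (g N θ - c))‖ ≤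
        ∫ θ in s, e θ ^ N * (ε / 2) := by
      refine norm_integral_le_of_norm_le ?_ (ae_of_all _ fun θ => ?_)
      · exact Continuous.continuousOn (by fun_prop) |>.integrableOn_compact isCompact_Icc
      · rw [norm_smul, Real.norm_of_nonneg (pow_pos (Real.exp_pos _) _).le, norm_mul]
        have h6 : ‖Complex.exp (k * θ * Complex.I)‖ = 1 := by
          have := Complex.norm_exp_ofReal_mul_I (k * θ)
          push_cast at this
          exact this
        rw [h6, one_mul]
        exact mul_le_mul_of_nonneg_left (hN θ) (pow_pos (Real.exp_pos _) _).le
    rw [integral_mul_const] at h5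
    have := hZ N
    nlinarith
  have := tendsto_nhds_unique hpeak hzero
  rcases mul_eq_zero.1 this with h | h
  · exact absurd h (Complex.exp_ne_zero _)
  · exact h

theorem eventually_norm_sub_le_of_continuous {F : CSpace n → ℂ} (hF : Continuous F)
    (ζ : CSpace n) {v : ℕ → ℝ → CSpace n} {C : ℝ} (hv : ∀ N θ, N * ‖v N θ‖ ≤ C) {ε : ℝ}
    (hε : 0 < ε) : ∀ᶠ N in atTop, ∀ θ, ‖F (ζ + v N θ) - F ζ‖ ≤ ε := by
  obtain ⟨δ, hδ, h⟩ := Metric.continuous_iff.1 hF ζ ε hε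
  obtain ⟨N₀, hN₀⟩ := exists_nat_gt (C / δ)
  filter_upwards [eventually_gt_atTop N₀, eventually_gt_atTop 0] with N hN hN0 θ
  rw [← dist_eq_norm]
  refine (h _ ?_).le
  rw [dist_eq_norm, add_sub_cancel_left]
  rw [div_lt_iff₀ hδ] at hN₀
  have h1 : (N₀ : ℝ) < N := by exact_mod_cast hN
  have h2 : (0 : ℝ) < N := by exact_mod_cast hN0
  have := hv N θ
  by_contra! hcon
  nlinarith

/-- A homogeneous solution of the twisted mean value equations vanishes at the points `ζ` which are
orthogonal to `j w`, but not to `w`. -/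
theorem eq_zero_of_twistedMean_of_inner_ne_zero {j : CSpace n →ₗᵢ[ℝ] CSpace n} {k : ℤ}
    {F : CSpace n → ℂ} (hF : Continuous F) {p : ℕ} (hp : ∀ (t : ℂ) ζ, F (t • ζ) = t ^ p * F ζ)
    {w ζ : CSpace n} (h0 : ∀ ζ, twistedMean j k w F ζ = 0) (hw : ⟪w, ζ⟫_ℂ ≠ 0)
    (hjw : ⟪j w, ζ⟫_ℂ = 0) : F ζ = 0 := by
  set a := ⟪w, ζ⟫_ℂ with ha
  refine tendsto_integral_exp_neg_cos (k := k)
    (g := fun N θ => F (ζ + (a / N) • circleOrbit j θ w)) ?_ ?_ ?_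
  · intro N
    have := continuous_circleOrbit j
    fun_prop
  · intro ε hε
    refine eventually_norm_sub_le_of_continuous hF ζ
      (v := fun N θ => (a / N) • circleOrbit j θ w) (C := ‖a‖ * (2 * ‖w‖)) ?_ hε
    intro N θ
    rcases Nat.eq_zero_or_pos N with rfl | hN
    · simp; positivity
    have hN' : (0 : ℝ) < N := by exact_mod_cast hN
    rw [norm_smul, norm_div, Complex.norm_natCast, ← mul_assoc, mul_div_cancel₀ _ hN'.ne']
    exact mul_le_mul_of_nonneg_left (norm_circleOrbit_le j θ w) (norm_nonneg _)
  · intro N hN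
    have hN' : (N : ℂ) ≠ 0 := by exact_mod_cast hN.ne'
    -- At (N/a)ζ the exponent is exactly -N cos θ, because jw ⊥ ζ. Homogeneity takes out (N/a)^p and
    -- leaves F at points within O(1/N) of ζ.
    have h1 := h0 ((N / a) • ζ)
    rw [twistedMean] at h1
    have h2 : ∀ θ : ℝ, Complex.exp (k * θ * Complex.I) *
        (Complex.exp (-⟪circleOrbit j θ w, (N / a) • ζ⟫_ℂ) *
          F ((N / a) • ζ + circleOrbit j θ w)) =
        (N / a) ^ p * (Complex.exp (k * θ * Complex.I) *
      (Complex.exp (-(N * Real.cos θ)) * F (ζ + (a / N) • circleOrbit j θ w))) := by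
      intro θ
      have h3 : (N / a) • ζ + circleOrbit j θ w =
          (N / a) • (ζ + (a / N) • circleOrbit j θ w) := by
        rw [smul_add, smul_smul, div_mul_div_cancel₀ hw, div_self hN', one_smul]
      have h4 : ⟪circleOrbit j θ w, (N / a) • ζ⟫_ℂ = N * Real.cos θ := by
        rw [inner_smul_right, inner_circleOrbit_left, hjw, ← ha]
        field_simp
        ring
      rw [h3, h4, hp]
      ring
    simp only [h2] at h1
    rw [intervalIntegral.integral_const_mul] at h1
    exact (mul_eq_zero.1 h1).resolve_left (pow_ne_zero _ (div_ne_zero hN' hw))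

/-- The twisted mean value equations for the complex structure `j = i`. -/
theorem eq_zero_of_twistedMean_of_orthogonal {K : ℕ} (hK : K ≠ 0) {F : CSpace n → ℂ}
    (hF : Continuous F) {p : ℕ} (hp : ∀ (t : ℂ) ζ, F (t • ζ) = t ^ p * F ζ) {w ζ : CSpace n}
    (hwζ : ⟪w, ζ⟫_ℂ = 0) (hw : ‖w‖ ^ 2 = K)
    (h0 : ∀ ζ, ∫ θ in (0 : ℝ)..2 * Real.pi, Complex.exp (K * θ * Complex.I) *
      (Complex.exp (-⟪w, ζ⟫_ℂ * Complex.exp (-(θ * Complex.I))) *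
        F (ζ + Complex.exp (θ * Complex.I) • w)) = 0) : F ζ = 0 := by
  set G : ℕ → ℝ → ℂ := fun N θ => Complex.exp (K * θ * Complex.I) *
      (Complex.exp (-K * Complex.exp (-(θ * Complex.I))) *
        F (ζ + ((1 + Complex.exp (θ * Complex.I)) / N) • w)) with hG
  have hww : ⟪w, w⟫_ℂ = K := inner_self_eq_of_norm_sq hw
  have h1 : ∀ N : ℕ, 0 < N → ∫ θ in (0 : ℝ)..2 * Real.pi, G N θ = 0 := by
    intro N hN
    have hN' : (N : ℂ) ≠ 0 := by exact_mod_cast hN.ne'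
    -- At Nζ alone the exponential factor would be 1, and the limiting coefficient ∫ e^{iKθ} dθ
    -- would vanish. The shift by w changes the exponent to -K e^{-iθ}, independent of N.
    have h := h0 ((N : ℂ) • ζ + w)
    have h2 : ∀ θ : ℝ, Complex.exp (K * θ * Complex.I) *
      (Complex.exp (-⟪w, (N : ℂ) • ζ + w⟫_ℂ * Complex.exp (-(θ * Complex.I))) *
        F ((N : ℂ) • ζ + w + Complex.exp (θ * Complex.I) • w)) = N ^ p * G N θ := by
      intro θ
      have h3 : (N : ℂ) • ζ + w + Complex.exp (θ * Complex.I) • w =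
          (N : ℂ) • (ζ + ((1 + Complex.exp (θ * Complex.I)) / N) • w) := by
        rw [smul_add, smul_smul, mul_div_cancel₀ _ hN', add_smul, one_smul, add_assoc]
      rw [h3, hp, inner_add_right, inner_smul_right, hwζ, hww, mul_zero, zero_add, hG]
      ring
    simp only [h2] at h
    rw [intervalIntegral.integral_const_mul] at h
    exact (mul_eq_zero.1 h).resolve_left (pow_ne_zero _ hN')
  have h2 : Tendsto (fun N => ∫ θ in (0 : ℝ)..2 * Real.pi, G N θ) atTop
      (𝓝 (∫ θ in (0 : ℝ)..2 * Real.pi, Complex.exp (K * θ * Complex.I) *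
      (Complex.exp (-K * Complex.exp (-(θ * Complex.I))) * F ζ))) := by
    obtain ⟨C, hC⟩ := (isCompact_closedBall ζ (2 * ‖w‖)).exists_bound_of_continuousOn
      hF.continuousOn
    have hone : ∀ θ : ℝ, ‖1 + Complex.exp (θ * Complex.I)‖ ≤ 2 := fun θ => by
      refine (norm_add_le _ _).trans ?_
      rw [Complex.norm_exp_ofReal_mul_I, norm_one]
      norm_num
    refine intervalIntegral.tendsto_integral_filter_of_dominated_convergence
      (fun _ => Real.exp K * C) ?_ ?_ (by simp) ?_
    · refine Eventually.of_forall fun N => ?_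
      apply Continuous.aestronglyMeasurable
      simp only [hG]
      fun_prop
    · filter_upwards [eventually_gt_atTop 0] with N hN
      refine ae_of_all _ fun θ _ => ?_
      have h6 : ‖Complex.exp (K * θ * Complex.I)‖ = 1 := by
        have := Complex.norm_exp_ofReal_mul_I (K * θ)
        push_cast at this
        exact this
      have hNN : (1 : ℝ) ≤ N := by exact_mod_cast hN
      rw [hG, norm_mul, norm_mul, h6, one_mul]
      refine mul_le_mul ?_ (hC _ ?_) (norm_nonneg _) (Real.exp_pos _).le
      · rw [Complex.norm_exp]
        apply Real.exp_le_exp.2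
        refine (Complex.re_le_norm _).trans ?_
        rw [norm_mul, norm_neg, Complex.norm_natCast]
        have := Complex.norm_exp_ofReal_mul_I (-θ)
        push_cast at this
        rw [neg_mul] at this
        rw [this, mul_one]
      · rw [mem_closedBall_iff_norm, add_sub_cancel_left, norm_smul, norm_div,
          Complex.norm_natCast]
        refine mul_le_mul_of_nonneg_right ?_ (norm_nonneg _)
        exact (div_le_self (norm_nonneg _) hNN).trans (hone θ)
    · refine ae_of_all _ fun θ _ => ?_
      have h7 : Tendsto (fun N : ℕ => ζ + ((1 + Complex.exp (θ * Complex.I)) / N) • w) atTop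
          (𝓝 (ζ + (0 : ℂ) • w)) :=
        ((tendsto_const_div_atTop_nhds_zero_nat _).smul_const w).const_add ζ
      rw [zero_smul, add_zero] at h7
      exact (((hF.tendsto ζ).comp h7).const_mul _).const_mul _
  have h3 : Tendsto (fun N => ∫ θ in (0 : ℝ)..2 * Real.pi, G N θ) atTop (𝓝 0) := by
    refine tendsto_const_nhds.congr' ?_
    filter_upwards [eventually_gt_atTop 0] with N hN
    exact (h1 N hN).symm
  have h4 := tendsto_nhds_unique h2 h3
  simp only [← mul_assoc] at h4
  -- The coefficient of F(ζ) in the limit is 2π(-K)^K/K!.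
  rw [intervalIntegral.integral_mul_const, integral_exp_mul_exp_exp, mul_eq_zero] at h4
  refine h4.resolve_left (mul_ne_zero ?_ (div_ne_zero (pow_ne_zero _ ?_) ?_))
  · exact_mod_cast Real.two_pi_pos.ne'
  · exact neg_ne_zero.2 (by exact_mod_cast hK)
  · exact_mod_cast Nat.factorial_ne_zero _

/-- At ζ = w every value of F in the integral lies on the complex line of w, so homogeneity turns
the equation into F(w) times a scalar. That scalar is the Laguerre-type sum shown to be non-zero
above. -/
theorem eq_zero_of_twistedMean_of_odd {K : ℕ} (hK : Odd K) {F : CSpace n → ℂ}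
    {p : ℕ} (hp : ∀ (t : ℂ) ζ, F (t • ζ) = t ^ p * F ζ) {w : CSpace n} (hw : ‖w‖ ^ 2 = K)
    (h0 : ∀ ζ, ∫ θ in (0 : ℝ)..2 * Real.pi, Complex.exp (K * θ * Complex.I) *
      (Complex.exp (-⟪w, ζ⟫_ℂ * Complex.exp (-(θ * Complex.I))) *
        F (ζ + Complex.exp (θ * Complex.I) • w)) = 0) : F w = 0 := by
  have hww : ⟪w, w⟫_ℂ = K := inner_self_eq_of_norm_sq hw
  have h := h0 w
  have h1 : ∀ θ : ℝ, F (w + Complex.exp (θ * Complex.I) • w) =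
      (1 + Complex.exp (θ * Complex.I)) ^ p * F w := fun θ => by
    rw [← hp, add_smul, one_smul]
  simp only [h1, hww, ← mul_assoc] at h
  rw [intervalIntegral.integral_mul_const] at h
  simp only [mul_assoc] at h
  have h2 := integral_exp_mul_exp_exp_mul_pow K (-K) p
  simp only [mul_assoc] at h2
  rw [h2, mul_eq_zero] at h
  refine h.resolve_left ?_
  have h3 : (2 * Real.pi : ℂ) ≠ 0 := by exact_mod_cast Real.two_pi_pos.ne'
  rw [← mul_assoc]
  exact mul_ne_zero h3 (sum_choose_mul_pow_div_factorial_ne_zero hK p)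

end TwistedMean

theorem re_inner_eq {n : ℕ} (x y : CSpace n) :
    (⟪x, y⟫_ℂ).re = (‖x + y‖ ^ 2 - ‖x‖ ^ 2 - ‖y‖ ^ 2) / 2 := by
  have h := @norm_add_sq ℂ _ _ _ _ x y
  simp only [RCLike.re_to_complex] at h
  linarith

/-- Since j is only real linear, polarization gives the real part of the Hermitian product and
nothing about the imaginary part. -/
theorem re_inner_map_map {n : ℕ} (j : CSpace n →ₗᵢ[ℝ] CSpace n) (x y : CSpace n) :
    (⟪j x, j y⟫_ℂ).re = (⟪x, y⟫_ℂ).re := by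
  rw [re_inner_eq, re_inner_eq, ← map_add]
  simp only [LinearIsometry.norm_map]

/-! ### Orthogonal complex structures on ℂⁿ with Im⟪jx, x⟫ = κ|x|². -/

section ComplexStructure

variable {n : ℕ} {j : CSpace n →ₗᵢ[ℝ] CSpace n} (hj : ∀ x, j (j x) = -x) {κ : ℝ}
  (hκ : ∀ x, (⟪j x, x⟫_ℂ).im = κ * ‖x‖ ^ 2)

include hj in
theorem re_inner_map_left (x y : CSpace n) : (⟪j x, y⟫_ℂ).re = -(⟪x, j y⟫_ℂ).re := by
  rw [← re_inner_map_map j, hj, inner_neg_left, Complex.neg_re]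

include hj in
theorem re_inner_map_self (x : CSpace n) : (⟪j x, x⟫_ℂ).re = 0 := by
  have h := re_inner_map_left hj x x
  have h2 : (⟪x, j x⟫_ℂ).re = (⟪j x, x⟫_ℂ).re := by
    rw [← inner_conj_symm, Complex.conj_re]
  linarith

include hκ in
/-- If `κ ^ 2 = 1`, then `j` is multiplication by `-κ i`. -/
theorem eq_smul_of_sq_eq_one (h : κ ^ 2 = 1) (x : CSpace n) :
    j x = (-κ * Complex.I : ℂ) • x := by
  rw [← sub_eq_zero, ← norm_eq_zero, ← sq_eq_zero_iff, @norm_sub_sq ℂ]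
  have h2 : ‖(-κ * Complex.I : ℂ)‖ ^ 2 = 1 := by
    rw [norm_mul, norm_neg, Complex.norm_I, mul_one, Complex.norm_real, Real.norm_eq_abs, sq_abs, h]
  rw [inner_smul_right, norm_smul, mul_pow, h2, LinearIsometry.norm_map]
  have h3 : (RCLike.re (-κ * Complex.I * ⟪j x, x⟫_ℂ) : ℝ) = κ * (⟪j x, x⟫_ℂ).im := by
    simp
  rw [h3, hκ]
  linear_combination -2 * ‖x‖ ^ 2 * h

include hj hκ in
/-- If `κ ^ 2 ≠ 1`, then there are vectors `w` such that `j w` is orthogonal to a given `ζ ≠ 0`,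
but `w` is not. -/
theorem exists_inner_map_eq_zero (h : κ ^ 2 ≠ 1) {ζ : CSpace n} (hζ : ζ ≠ 0) {r : ℝ}
    (hr : 0 < r) : ∃ w, ‖w‖ = r ∧ ⟪w, ζ⟫_ℂ ≠ 0 ∧ ⟪j w, ζ⟫_ℂ = 0 := by
  have hζ' : ‖ζ‖ ≠ 0 := norm_ne_zero_iff.2 hζ
  have hζc : ⟪ζ, ζ⟫_ℂ ≠ 0 := inner_self_ne_zero.2 hζ
  -- u is the part of jζ that is Hermitian orthogonal to ζ. With w a positive multiple of -ju, jw is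
  -- a multiple of u, and Re⟪w, ζ⟫ is a multiple of Re⟪u, jζ⟫ = |u|².
  set c : ℂ := ⟪ζ, j ζ⟫_ℂ / ⟪ζ, ζ⟫_ℂ with hc
  set u := j ζ - c • ζ with hu
  have huζ : ⟪ζ, u⟫_ℂ = 0 := by
    rw [hu, inner_sub_right, inner_smul_right, hc, div_mul_cancel₀ _ hζc, sub_self]
  have huζ' : ⟪u, ζ⟫_ℂ = 0 := by rw [← inner_conj_symm, huζ, map_zero]
  have hu0 : u ≠ 0 := by
    -- If u = 0 then jζ = cζ with c purely imaginary (Re⟪jζ, ζ⟫ = 0) and of modulus one; as κ = -Im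
    -- c, this gives κ² = 1.
    intro h0
    apply h
    have h1 : j ζ = c • ζ := sub_eq_zero.1 h0
    have h2 : ⟪j ζ, ζ⟫_ℂ = (starRingEnd ℂ c) * (‖ζ‖ ^ 2 : ℝ) := by
      rw [h1, inner_smul_left, inner_self_eq_norm_sq_to_K]
      push_cast
      rfl
    have h3 := re_inner_map_self hj ζ
    have h4 := hκ ζ
    rw [h2, Complex.re_mul_ofReal, Complex.conj_re] at h3
    rw [h2, Complex.im_mul_ofReal, Complex.conj_im] at h4
    have h5 : c.re = 0 := (mul_eq_zero.1 h3).resolve_right (pow_ne_zero _ hζ')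
    have h6 : -c.im = κ := mul_right_cancel₀ (pow_ne_zero 2 hζ') h4
    have h7 : ‖c‖ = 1 := by
      have := congrArg norm h1
      rw [LinearIsometry.norm_map, norm_smul] at this
      exact (mul_eq_right₀ hζ').1 this.symm
    have h8 := Complex.sq_norm c
    rw [h7, Complex.normSq_apply, h5] at h8
    rw [← h6]
    linarith
  have hun : ‖u‖ ≠ 0 := norm_ne_zero_iff.2 hu0
  refine ⟨(r / ‖u‖) • -j u, ?_, ?_, ?_⟩
  · rw [norm_smul, norm_neg, LinearIsometry.norm_map, Real.norm_of_nonneg (by positivity),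
      div_mul_cancel₀ _ hun]
  · rw [inner_ofReal_smul_left]
    refine mul_ne_zero (by exact_mod_cast div_ne_zero hr.ne' hun) fun h0 => ?_
    have h1 := congrArg Complex.re h0
    rw [inner_neg_left, Complex.neg_re, re_inner_map_left hj, neg_neg] at h1
    have h2 : j ζ = u + c • ζ := by rw [hu, sub_add_cancel]
    rw [h2, inner_add_right, inner_smul_right, huζ', mul_zero, add_zero,
      inner_self_eq_norm_sq_to_K, Complex.zero_re] at h1
    have h3 : ((‖u‖ : ℂ) ^ 2).re = ‖u‖ ^ 2 := by norm_cast
    exact pow_ne_zero 2 hun (h3.symm.trans h1)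
  · rw [map_smul, map_neg, hj, neg_neg, inner_ofReal_smul_left, huζ', mul_zero]

theorem exists_orthogonal_of_one_lt (hn : 1 < n) (ζ : CSpace n) {r : ℝ} (hr : 0 < r) :
    ∃ w, ‖w‖ = r ∧ ⟪w, ζ⟫_ℂ = 0 := by
  have h1 : (ℂ ∙ ζ)ᗮ ≠ ⊥ := by
    intro h
    have h2 := Submodule.finrank_add_finrank_orthogonal (ℂ ∙ ζ)
    rw [h, finrank_bot, add_zero, finrank_euclideanSpace_fin] at h2
    have : Module.finrank ℂ (ℂ ∙ ζ) ≤ 1 := finrank_span_le_card {ζ} |>.trans (by simp)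
    omega
  obtain ⟨w, hw, hw0⟩ := Submodule.exists_mem_ne_zero_of_ne_bot h1
  have hwn : ‖w‖ ≠ 0 := norm_ne_zero_iff.2 hw0
  refine ⟨(r / ‖w‖) • w, ?_, ?_⟩
  · rw [norm_smul, Real.norm_of_nonneg (by positivity), div_mul_cancel₀ _ hwn]
  · rw [inner_ofReal_smul_left, (Submodule.mem_orthogonal' _ _).1 hw ζ
      (Submodule.mem_span_singleton_self ζ), mul_zero]

theorem circleOrbit_of_eq_smul {ε : ℝ} (hε : ∀ x, j x = (ε * Complex.I : ℂ) • x)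
    (h1 : ε ^ 2 = 1) (θ : ℝ) (w : CSpace n) :
    circleOrbit j θ w = Complex.exp (ε * θ * Complex.I) • w := by
  rw [circleOrbit, hε, ← Complex.coe_smul, ← Complex.coe_smul, smul_smul, ← add_smul]
  congr 1
  rcases sq_eq_one_iff.1 h1 with rfl | rfl
  · simp [Complex.exp_mul_I]
  · have h2 : (((-1 : ℝ) : ℂ) * θ * Complex.I) = (-θ : ℂ) * Complex.I := by
      push_cast
      ring
    rw [h2, Complex.exp_mul_I]
    simp

/-- Here e^{θj}w = e^{iεθ}w. For ε = -1, reversing the circle brings the integral to the form for ε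
= 1, so that both signs are treated together. -/
theorem twistedMean_of_eq_smul {ε : ℤ} (hε : ∀ x, j x = ((ε : ℝ) * Complex.I : ℂ) • x)
    (h1 : ε ^ 2 = 1) (K : ℕ) (w : CSpace n) (F : CSpace n → ℂ) (ζ : CSpace n) :
    twistedMean j (ε * K) w F ζ =
      ∫ θ in (0 : ℝ)..2 * Real.pi, Complex.exp (K * θ * Complex.I) *
        (Complex.exp (-⟪w, ζ⟫_ℂ * Complex.exp (-(θ * Complex.I))) *
          F (ζ + Complex.exp (θ * Complex.I) • w)) := by
  have h2 : ((ε : ℝ)) ^ 2 = 1 := by exact_mod_cast h1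
  simp only [twistedMean, circleOrbit_of_eq_smul hε h2, inner_smul_left]
  rcases sq_eq_one_iff.1 h1 with rfl | rfl
  · refine intervalIntegral.integral_congr fun θ _ => ?_
    simp only [← Complex.exp_conj]
    simp
    ring_nf
    simp
  · rw [← integral_two_pi_sub]
    refine intervalIntegral.integral_congr fun θ _ => ?_
    have h3 := exp_two_pi_sub_mul_I (-1) θ
    have h4 := exp_two_pi_sub_mul_I (-1 * K) θ
    simp only [← Complex.exp_conj]
    push_cast at h3 h4 ⊢
    simp only [neg_mul, one_mul, neg_neg] at h3 h4 ⊢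
    rw [h3, h4]
    have h5 : Complex.exp ((starRingEnd ℂ) (-((2 * Real.pi - θ) * Complex.I))) =
        Complex.exp (-(θ * Complex.I)) := by
      rw [Complex.exp_conj, h3, ← Complex.exp_conj]
      simp
    rw [h5]
    ring_nf

include hj hκ in
/-- Homogeneous solutions of the twisted mean value equations are zero. -/
theorem eq_zero_of_twistedMean_of_homogeneous {r : ℝ} (hr : 0 < r) {k : ℤ}
    (hk : κ * r ^ 2 = -k) (hn : 1 < n ∨ n = 1 ∧ Odd k ∧ κ ^ 2 = 1) {F : CSpace n → ℂ}
    (hF : Continuous F) {p : ℕ} (hp : ∀ (t : ℂ) ζ, F (t • ζ) = t ^ p * F ζ)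
    (h0 : ∀ w, ‖w‖ = r → ∀ ζ, twistedMean j k w F ζ = 0) (ζ : CSpace n) : F ζ = 0 := by
  have key : ∀ ζ ≠ 0, F ζ = 0 := by
    intro ζ hζ
    have hζ' : ‖ζ‖ ≠ 0 := norm_ne_zero_iff.2 hζ
    by_cases hκ1 : κ ^ 2 = 1
    · obtain ⟨ε, hε, rfl⟩ : ∃ ε : ℤ, ε ^ 2 = 1 ∧ κ = -ε := by
        rcases sq_eq_one_iff.1 hκ1 with rfl | rfl
        · exact ⟨-1, by norm_num, by norm_num⟩
        · exact ⟨1, by norm_num, by norm_num⟩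
      have hjε : ∀ x, j x = ((ε : ℝ) * Complex.I : ℂ) • x := by
        intro x
        rw [eq_smul_of_sq_eq_one hκ hκ1 x]
        push_cast
        rw [neg_neg]
      have hεR : (ε : ℝ) * ε = 1 := by exact_mod_cast (sq ε).symm.trans hε
      -- With κ = -ε, `hk` reads r² = εk. Thus K = εk is a positive integer, the square radius of
      -- the sphere.
      have hr2 : r ^ 2 = (ε * k : ℤ) := by
        push_cast
        linear_combination (-(ε : ℝ)) * hk - r ^ 2 * hεR
      have hpos : 0 < ε * k := by
        have : (0 : ℝ) < (ε * k : ℤ) := hr2 ▸ pow_pos hr 2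
        exact_mod_cast this
      obtain ⟨K, hK⟩ := Int.eq_ofNat_of_zero_le hpos.le
      have hkK : k = ε * K := by
        linear_combination ε * hK - k * hε
      have hK0 : K ≠ 0 := by
        rintro rfl
        simp [hK] at hpos
      have hrK : r ^ 2 = K := by rw [hr2, hK]; simp
      simp only [hkK, twistedMean_of_eq_smul hjε hε] at h0
      rcases hn with hn | ⟨-, hodd, -⟩
      · obtain ⟨w, hw, hwζ⟩ := exists_orthogonal_of_one_lt hn ζ hr
        exact eq_zero_of_twistedMean_of_orthogonal hK0 hF hp hwζ (by rw [hw, hrK]) (h0 w hw)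
      · have hKodd : Odd K := by
          rw [hkK, Int.odd_mul] at hodd
          exact_mod_cast hodd.2
        have hw : ‖((r / ‖ζ‖ : ℝ) : ℂ) • ζ‖ = r := by
          rw [norm_smul, Complex.norm_real, Real.norm_of_nonneg (by positivity),
            div_mul_cancel₀ _ hζ']
        have h1 := eq_zero_of_twistedMean_of_odd hKodd hp (by rw [hw, hrK]) (h0 _ hw)
        rw [hp] at h1
        refine (mul_eq_zero.1 h1).resolve_left (pow_ne_zero _ ?_)
        exact_mod_cast div_ne_zero hr.ne' hζ'
    · obtain ⟨w, hw, hwζ, hjw⟩ := exists_inner_map_eq_zero hj hκ hκ1 hζ hr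
      exact eq_zero_of_twistedMean_of_inner_ne_zero hF hp (h0 w hw) hwζ hjw
  -- The origin is reached by homogeneity with t = 0 from a point ξ ≠ 0 where F already vanishes;
  -- this also covers p = 0.
  rcases eq_or_ne ζ 0 with rfl | hζ
  · have : Nonempty (Fin n) := ⟨⟨0, by omega⟩⟩
    obtain ⟨ξ, hξ⟩ := exists_ne (0 : CSpace n)
    have h1 := hp 0 ξ
    rwa [zero_smul, key ξ hξ, mul_zero] at h1
  · exact key ζ hζ

end ComplexStructure

/-! ### Passage from entire functions to their homogeneous components. -/

theorem intervalIntegral_swap_of_continuous {f : ℝ → ℝ → ℂ} (hf : Continuous (Function.uncurry f))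
    {a b : ℝ} (hab : a ≤ b) :
    ∫ x in a..b, ∫ y in a..b, f x y = ∫ y in a..b, ∫ x in a..b, f x y := by
  simp only [intervalIntegral.integral_of_le hab]
  refine integral_integral_swap ?_
  rw [Measure.prod_restrict, ← Measure.volume_eq_prod]
  refine (hf.continuousOn.integrableOn_compact
    (isCompact_Icc.prod isCompact_Icc : IsCompact (Set.Icc a b ×ˢ Set.Icc a b))).mono_set ?_
  exact Set.prod_mono Set.Ioc_subset_Icc_self Set.Ioc_subset_Icc_self

/-- The component is a weighted average of the rotates F(c·) and the equation is linear in F, so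
Fubini applies. All rotates have to be assumed to satisfy the equation. -/
theorem twistedMean_homogPart {n : ℕ} {j : CSpace n →ₗᵢ[ℝ] CSpace n} {k : ℤ} {w : CSpace n}
    {F : CSpace n → ℂ} (hF : Continuous F) (ζ : CSpace n) (p : ℕ)
    (h : ∀ c : ℂ, ‖c‖ = 1 → twistedMean j k w (fun ξ => F (c • ξ)) ζ = 0) :
    twistedMean j k w (homogPart p F) ζ = 0 := by
  have hj := continuous_circleOrbit j
  simp only [twistedMean, homogPart]
  simp only [← intervalIntegral.integral_const_mul]
  rw [intervalIntegral_swap_of_continuous _ (by positivity)]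
  · have h1 : ∀ α : ℝ, ∫ θ in (0 : ℝ)..2 * Real.pi, Complex.exp (k * θ * Complex.I) *
        (Complex.exp (-⟪circleOrbit j θ w, ζ⟫_ℂ) * (Complex.exp (-(p * α * Complex.I)) *
          F (Complex.exp (α * Complex.I) • (ζ + circleOrbit j θ w)))) = 0 := by
      intro α
      have h2 := h (Complex.exp (α * Complex.I)) (Complex.norm_exp_ofReal_mul_I α)
      rw [← mul_zero (Complex.exp (-(p * α * Complex.I))), ← h2, twistedMean,
        ← intervalIntegral.integral_const_mul]
      refine intervalIntegral.integral_congr fun θ _ => ?_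
      ring
    simp only [h1, intervalIntegral.integral_zero]
  · unfold Function.uncurry
    fun_prop

/-- An entire function is zero if all its rotations satisfy the twisted mean value equations. -/
theorem eq_zero_of_twistedMean {n : ℕ} {j : CSpace n →ₗᵢ[ℝ] CSpace n} (hj : ∀ x, j (j x) = -x)
    {κ : ℝ} (hκ : ∀ x, (⟪j x, x⟫_ℂ).im = κ * ‖x‖ ^ 2) {r : ℝ} (hr : 0 < r) {k : ℤ}
    (hk : κ * r ^ 2 = -k) (hn : 1 < n ∨ n = 1 ∧ Odd k ∧ κ ^ 2 = 1) {F : CSpace n → ℂ}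
    (hF : Differentiable ℂ F) (h : ∀ w, ‖w‖ = r → ∀ c : ℂ, ‖c‖ = 1 → ∀ ζ,
      twistedMean j k w (fun ξ => F (c • ξ)) ζ = 0) (ζ : CSpace n) : F ζ = 0 :=
  eq_zero_of_homogPart_eq_zero hF fun p =>
    eq_zero_of_twistedMean_of_homogeneous hj hκ hr hk hn (continuous_homogPart hF.continuous p)
      (homogPart_smul hF p)
      (fun w hw ζ => twistedMean_homogPart hF.continuous ζ p fun c hc => h w hw c hc ζ) ζ

/-! ### Rotations and composition of translations on Fock space. -/

theorem measurePreserving_fockMeasure {n : ℕ} (e : CSpace n ≃ₗᵢ[ℝ] CSpace n) :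
    MeasurePreserving e (fockMeasure n) (fockMeasure n) := by
  have hm : Measurable e := e.continuous.measurable
  refine ⟨hm, ?_⟩
  refine Measure.ext_of_lintegral _ fun f hf => ?_
  have h := FockSpace.lintegral_fockMeasure (hf.comp hm)
  simp only [Function.comp_apply] at h
  rw [lintegral_map hf hm, h,
    FockSpace.lintegral_fockMeasure hf, ← e.measurePreserving.lintegral_comp
      (f := fun ζ => ENNReal.ofReal (Real.exp (-‖ζ‖ ^ 2)) * f ζ) (by fun_prop)]
  simp only [LinearIsometryEquiv.norm_map]

namespace FockSpace

/-- Multiplication by a complex number of modulus one. -/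
def phaseIso (n : ℕ) (c : ℂ) (hc : ‖c‖ = 1) : CSpace n ≃ₗᵢ[ℝ] CSpace n :=
  LinearIsometry.toLinearIsometryEquiv
    { toFun := fun ζ => c • ζ
      map_add' := smul_add c
      map_smul' := fun a ζ => smul_comm c a ζ
      norm_map' := fun ζ => by
        change ‖c • ζ‖ = ‖ζ‖
        rw [norm_smul, hc, one_mul] } rfl

variable {n : ℕ}

theorem phaseIso_apply (c : ℂ) (hc : ‖c‖ = 1) (ζ : CSpace n) : phaseIso n c hc ζ = c • ζ := rfl

/-- The unitary operator `F ↦ F (c ·)` of Fock space, `|c| = 1`. -/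
def rotate (c : ℂ) (hc : ‖c‖ = 1) : FockSpace n →ₗᵢ[ℂ] FockSpace n where
  toFun F := ⟨fun ζ => F (c • ζ), F.differentiable.comp (differentiable_id.const_smul c),
    F.memLp.comp_measurePreserving (measurePreserving_fockMeasure (phaseIso n c hc))⟩
  map_add' _ _ := rfl
  map_smul' _ _ := rfl
  norm_map' F := by
    rw [← ENNReal.ofReal_eq_ofReal_iff (norm_nonneg _) (norm_nonneg _), ofReal_norm_eq,
      ofReal_norm_eq]
    exact eLpNorm_comp_measurePreserving F.differentiable.continuous.aestronglyMeasurable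
      (measurePreserving_fockMeasure (phaseIso n c hc))

theorem rotate_apply (c : ℂ) (hc : ‖c‖ = 1) (F : FockSpace n) (ζ : CSpace n) :
    rotate c hc F ζ = F (c • ζ) := rfl

/-- Multiplication by c preserves the Hermitian product, so conjugation by a rotation only moves the
translation vector from w to cw. -/
theorem translate_rotate (c : ℂ) (hc : ‖c‖ = 1) (w : CSpace n) (F : FockSpace n) :
    translate w (rotate c hc F) = rotate c hc (translate (c • w) F) := by
  refine ext fun ζ => ?_
  have h1 : ⟪c • w, c • ζ⟫_ℂ = ⟪w, ζ⟫_ℂ := by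
    rw [inner_smul_left, inner_smul_right, ← mul_assoc, ← Complex.normSq_eq_conj_mul_self,
      Complex.normSq_eq_norm_sq, hc]
    simp
  rw [translate_apply, rotate_apply, rotate_apply, translate_apply, h1, norm_smul, hc, one_mul,
    smul_add]

theorem inner_rotate_translate_rotate (c : ℂ) (hc : ‖c‖ = 1) (w : CSpace n) (F : FockSpace n) :
    ⟪rotate c hc F, translate w (rotate c hc F)⟫_ℂ = ⟪F, translate (c • w) F⟫_ℂ := by
  rw [translate_rotate, LinearIsometry.inner_map_map]

/-- The Weyl relation: translations form a projective representation whose cocycle is the imaginary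
part of the Hermitian product. -/
theorem translate_translate (a b : CSpace n) (F : FockSpace n) :
    translate a (translate b F) =
      Complex.exp (-((⟪b, a⟫_ℂ).im * Complex.I)) • translate (a + b) F := by
  refine ext fun ζ => ?_
  rw [smul_apply, translate_apply, translate_apply, translate_apply, ← mul_assoc, ← mul_assoc,
    ← Complex.exp_add, ← Complex.exp_add, add_assoc]
  congr 2
  have h1 : ((‖a + b‖ : ℂ)) ^ 2 = (‖a‖ : ℂ) ^ 2 + 2 * ((⟪b, a⟫_ℂ).re : ℂ) + (‖b‖ : ℂ) ^ 2 := by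
    have h := @norm_add_sq ℂ _ _ _ _ b a
    simp only [RCLike.re_to_complex] at h
    rw [add_comm a b]
    exact_mod_cast h.trans (by ring)
  have h2 := Complex.re_add_im ⟪b, a⟫_ℂ
  rw [h1, inner_add_right, inner_add_left]
  linear_combination h2

end FockSpace

/-! ### Orbit means and their square norms. -/

section OrbitMean

variable {n : ℕ} {j : CSpace n →ₗᵢ[ℝ] CSpace n}

theorem norm_circleOrbit (hj : ∀ x, j (j x) = -x) (θ : ℝ) (w : CSpace n) :
    ‖circleOrbit j θ w‖ = ‖w‖ := by
  rw [← sq_eq_sq₀ (norm_nonneg _) (norm_nonneg _), circleOrbit, @norm_add_sq ℂ,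
    inner_ofReal_smul_left, inner_ofReal_smul_right, norm_smul, norm_smul, j.norm_map]
  have h1 : (⟪w, j w⟫_ℂ).re = 0 := by
    rw [← inner_conj_symm, Complex.conj_re, re_inner_map_self hj]
  have h2 : (RCLike.re (Real.cos θ * (Real.sin θ * ⟪w, j w⟫_ℂ)) : ℝ) = 0 := by
    rw [← mul_assoc, ← Complex.ofReal_mul, RCLike.re_to_complex, Complex.re_ofReal_mul, h1, mul_zero]
  rw [h2, mul_pow, mul_pow, Real.norm_eq_abs, Real.norm_eq_abs, sq_abs, sq_abs]
  linear_combination ‖w‖ ^ 2 * Real.cos_sq_add_sin_sq θ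

/-- The isometry `exp (θ j)`. -/
def circleOrbitIso (hj : ∀ x, j (j x) = -x) (θ : ℝ) : CSpace n ≃ₗᵢ[ℝ] CSpace n :=
  LinearIsometry.toLinearIsometryEquiv
    { toFun := circleOrbit j θ
      map_add' := fun x y => by
        simp only [circleOrbit, map_add, smul_add]
        abel
      map_smul' := fun a x => by
        simp only [circleOrbit, map_smul, smul_add, RingHom.id_apply, smul_comm a]
      norm_map' := fun x => norm_circleOrbit hj θ x } rfl

/-- Both points lie in the real plane of w and jw, so only Im⟪jw, w⟫ = κ|w|² enters. The Weyl phase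
therefore depends on w through |w| alone. -/
theorem im_inner_circleOrbit {κ : ℝ} (hκ : ∀ x, (⟪j x, x⟫_ℂ).im = κ * ‖x‖ ^ 2) (θ φ : ℝ)
    (w : CSpace n) : (⟪circleOrbit j θ w, circleOrbit j φ w⟫_ℂ).im =
      Real.sin (θ - φ) * κ * ‖w‖ ^ 2 := by
  have h1 : (⟪w, j w⟫_ℂ).im = -(κ * ‖w‖ ^ 2) := by
    rw [← inner_conj_symm, Complex.conj_im, hκ]
  have h2 : ∀ x : CSpace n, (⟪x, x⟫_ℂ).im = 0 := fun x =>
    inner_self_im (𝕜 := ℂ) x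
  simp only [circleOrbit, inner_add_left, inner_add_right, inner_ofReal_smul_left,
    inner_ofReal_smul_right, Complex.add_im, Complex.im_ofReal_mul, h1, h2, hκ, Real.sin_sub]
  ring

/-- A chord of a circle is perpendicular to the radius through the midpoint of its arc. Its form, a
scalar times an isometry applied to w, allows the isometry to be averaged away. -/
theorem circleOrbit_sub_circleOrbit (θ φ : ℝ) (w : CSpace n) :
    circleOrbit j θ w - circleOrbit j φ w = (2 * Real.sin ((θ - φ) / 2)) •
      circleOrbit j ((θ + φ) / 2 + Real.pi / 2) w := by
  have h : circleOrbit j θ w - circleOrbit j φ w =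
      (Real.cos θ - Real.cos φ) • w + (Real.sin θ - Real.sin φ) • j w := by
    simp only [circleOrbit, sub_smul]
    abel
  rw [h, Real.cos_sub_cos, Real.sin_sub_sin, circleOrbit, Real.cos_add_pi_div_two,
    Real.sin_add_pi_div_two, smul_add, smul_smul, smul_smul]
  congr 2
  ring

namespace FockSpace

/-- The integral `∫ exp (i k θ) T (exp (θ j) w) F dθ` over `[0, 2π]`, where `T` is the projective
representation of `ℂⁿ` by translations. -/
def orbitMean (j : CSpace n →ₗᵢ[ℝ] CSpace n) (k : ℤ) (w : CSpace n) (F : FockSpace n) :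
    FockSpace n :=
  ∫ θ in (0 : ℝ)..2 * Real.pi, Complex.exp (k * θ * Complex.I) • translate (circleOrbit j θ w) F

theorem continuous_orbitMean_integrand (j : CSpace n →ₗᵢ[ℝ] CSpace n) (k : ℤ) (F : FockSpace n) :
    Continuous fun p : CSpace n × ℝ =>
      Complex.exp (k * p.2 * Complex.I) • translate (circleOrbit j p.2 p.1) F := by
  have h0 : Continuous fun p : CSpace n × ℝ => circleOrbit j p.2 p.1 := by
    have := j.continuous
    unfold circleOrbit
    fun_prop
  have h1 : Continuous fun p : CSpace n × ℝ => translate (circleOrbit j p.2 p.1) F :=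
    (continuous_translate F).comp h0
  fun_prop

theorem continuous_orbitMean (j : CSpace n →ₗᵢ[ℝ] CSpace n) (k : ℤ) (F : FockSpace n) :
    Continuous fun w => orbitMean j k w F :=
  intervalIntegral.continuous_parametric_intervalIntegral_of_continuous'
    (continuous_orbitMean_integrand j k F) _ _

theorem continuous_orbitMean_integrand_right (j : CSpace n →ₗᵢ[ℝ] CSpace n) (k : ℤ) (w : CSpace n)
    (F : FockSpace n) : Continuous fun θ : ℝ =>
      Complex.exp (k * θ * Complex.I) • translate (circleOrbit j θ w) F :=
  (continuous_orbitMean_integrand j k F).comp (by fun_prop : Continuous fun θ : ℝ => (w, θ))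

/-- Point evaluation is continuous and passes under the integral; |e^{θj}w| = |w| makes the Gaussian
factor constant in θ. -/
theorem orbitMean_apply (hj : ∀ x, j (j x) = -x) (k : ℤ) (w : CSpace n) (F : FockSpace n)
    (ζ : CSpace n) :
    orbitMean j k w F ζ = Complex.exp (-((‖w‖ : ℂ) ^ 2 / 2)) * twistedMean j k w F ζ := by
  rw [← evalL_apply, orbitMean, ← ContinuousLinearMap.intervalIntegral_comp_comm _
    ((continuous_orbitMean_integrand_right j k w F).intervalIntegrable _ _), twistedMean,
    ← intervalIntegral.integral_const_mul]
  refine intervalIntegral.integral_congr fun θ _ => ?_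
  simp only [evalL_apply, smul_apply, translate_apply, norm_circleOrbit hj]
  rw [sub_eq_add_neg, Complex.exp_add]
  ring

theorem inner_translate_circleOrbit {κ : ℝ} (hκ : ∀ x, (⟪j x, x⟫_ℂ).im = κ * ‖x‖ ^ 2)
    (θ φ : ℝ) (w : CSpace n) (F : FockSpace n) :
    ⟪translate (circleOrbit j φ w) F, translate (circleOrbit j θ w) F⟫_ℂ =
      Complex.exp (Real.sin (θ - φ) * κ * ‖w‖ ^ 2 * Complex.I) *
        ⟪F, translate ((2 * Real.sin ((θ - φ) / 2)) •
          circleOrbit j ((θ + φ) / 2 + Real.pi / 2) w) F⟫_ℂ := by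
  rw [inner_translate_left, translate_translate, inner_smul_right, inner_neg_right,
    Complex.neg_im, im_inner_circleOrbit hκ, neg_add_eq_sub, circleOrbit_sub_circleOrbit]
  push_cast
  ring_nf

theorem inner_orbitMean_self {κ : ℝ} (hκ : ∀ x, (⟪j x, x⟫_ℂ).im = κ * ‖x‖ ^ 2) (k : ℤ)
    (w : CSpace n) (F : FockSpace n) :
    ⟪orbitMean j k w F, orbitMean j k w F⟫_ℂ =
      ∫ φ in (0 : ℝ)..2 * Real.pi, ∫ θ in (0 : ℝ)..2 * Real.pi,
        Complex.exp (k * (θ - φ) * Complex.I) *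
        Complex.exp (Real.sin (θ - φ) * κ * ‖w‖ ^ 2 * Complex.I) *
        ⟪F, translate ((2 * Real.sin ((θ - φ) / 2)) •
          circleOrbit j ((θ + φ) / 2 + Real.pi / 2) w) F⟫_ℂ := by
  have hi := fun G : FockSpace n => ContinuousLinearMap.intervalIntegral_comp_comm (innerSL ℂ G)
    ((continuous_orbitMean_integrand_right j k w F).intervalIntegrable (μ := volume) 0 (2 * Real.pi))
  have h1 : ∀ φ : ℝ, ⟪orbitMean j k w F,
      Complex.exp (k * φ * Complex.I) • translate (circleOrbit j φ w) F⟫_ℂ =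
      starRingEnd ℂ (∫ θ in (0 : ℝ)..2 * Real.pi,
        Complex.exp (k * (θ - φ) * Complex.I) *
        Complex.exp (Real.sin (θ - φ) * κ * ‖w‖ ^ 2 * Complex.I) *
        ⟪F, translate ((2 * Real.sin ((θ - φ) / 2)) •
          circleOrbit j ((θ + φ) / 2 + Real.pi / 2) w) F⟫_ℂ) := by
    intro φ
    rw [← inner_conj_symm]
    congr 1
    refine (hi _).symm.trans (intervalIntegral.integral_congr fun θ _ => ?_)
    simp only [innerSL_apply_apply, inner_smul_left, inner_smul_right,
      inner_translate_circleOrbit hκ, ← Complex.exp_conj]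
    rw [← mul_assoc, ← mul_assoc, ← Complex.exp_add]
    congr 3
    simp
    ring
  -- Integrals are pulled out of the linear second variable only. Conjugate symmetry handles the
  -- first, and the conjugation cancels because the square norm is real.
  have h2 : ⟪orbitMean j k w F, orbitMean j k w F⟫_ℂ = starRingEnd ℂ
      ⟪orbitMean j k w F, orbitMean j k w F⟫_ℂ := (inner_conj_symm _ _).symm
  rw [h2]
  have h3 := (hi (orbitMean j k w F)).symm
  simp only [innerSL_apply_apply] at h3
  rw [← orbitMean] at h3
  rw [h3]
  simp only [h1]
  rw [intervalIntegral.integral_of_le (by positivity), integral_conj, RingHomCompTriple.comp_apply,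
    RingHom.id_apply, intervalIntegral.integral_of_le (by positivity)]

end FockSpace

end OrbitMean

/-! ### Averaging over a sphere and rotation invariance of the joint kernel. -/

section RotationInvariance

variable {n : ℕ}

/-- A continuous radial map, which is the projection to the sphere of radius `r` outside the unit
ball. -/
def radialMap (r : ℝ) (x : CSpace n) : CSpace n := (r / max ‖x‖ 1) • x

/-- A continuous radial cutoff function, which is positive exactly outside the unit ball. -/
def radialCutoff (x : CSpace n) : ℝ := max (min ‖x‖ 2 - 1) 0

theorem continuous_radialMap (r : ℝ) : Continuous (radialMap r : CSpace n → CSpace n) := by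
  unfold radialMap
  have h : Continuous fun x : CSpace n => max ‖x‖ 1 := by fun_prop
  have h2 : ∀ x : CSpace n, max ‖x‖ 1 ≠ 0 := fun x => (lt_max_of_lt_right one_pos).ne'
  exact (continuous_const.div h h2).smul continuous_id

theorem continuous_radialCutoff : Continuous (radialCutoff : CSpace n → ℝ) := by
  unfold radialCutoff
  fun_prop

theorem radialMap_map (r : ℝ) (e : CSpace n ≃ₗᵢ[ℝ] CSpace n) (x : CSpace n) :
    radialMap r (e x) = e (radialMap r x) := by
  rw [radialMap, radialMap, e.norm_map, map_smul]

theorem radialCutoff_map (e : CSpace n ≃ₗᵢ[ℝ] CSpace n) (x : CSpace n) :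
    radialCutoff (e x) = radialCutoff x := by
  rw [radialCutoff, radialCutoff, e.norm_map]

theorem radialCutoff_nonneg (x : CSpace n) : 0 ≤ radialCutoff x := le_max_right _ _

theorem radialCutoff_le_one (x : CSpace n) : radialCutoff x ≤ 1 :=
  max_le (by linarith [min_le_right ‖x‖ 2]) zero_le_one

theorem norm_radialMap {r : ℝ} (hr : 0 < r) {x : CSpace n} (hx : radialCutoff x ≠ 0) :
    ‖radialMap r x‖ = r := by
  have h : 1 < ‖x‖ := by
    by_contra! hcon
    apply hx
    exact max_eq_right (by linarith [min_le_left ‖x‖ 2])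
  rw [radialMap, max_eq_left h.le, norm_smul, Real.norm_of_nonneg (by positivity)]
  field_simp

/-- Invariance of the spherical mean under isometries, with a Gaussian integral of the radial
projection in place of surface measure. -/
theorem integral_radial_map (r : ℝ) (e : CSpace n ≃ₗᵢ[ℝ] CSpace n) (u : ℝ → ℂ)
    (q : CSpace n → ℂ) :
    ∫ x, radialCutoff x * (u ‖radialMap r x‖ * q (e (radialMap r x))) ∂(fockMeasure n) =
      ∫ x, radialCutoff x * (u ‖radialMap r x‖ * q (radialMap r x)) ∂(fockMeasure n) := by
  rw [← (measurePreserving_fockMeasure e).integral_comp e.toHomeomorph.measurableEmbedding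
    fun x => (radialCutoff x : ℂ) * (u ‖radialMap r x‖ * q (radialMap r x))]
  simp only [radialMap_map, radialCutoff_map, e.norm_map]

theorem integral_intervalIntegral_swap {f : CSpace n → ℝ → ℂ}
    (hf : Continuous (Function.uncurry f)) {C : ℝ} (hC : ∀ x y, ‖f x y‖ ≤ C) {a b : ℝ}
    (hab : a ≤ b) :
    ∫ x, (∫ y in a..b, f x y) ∂(fockMeasure n) = ∫ y in a..b, ∫ x, f x y ∂(fockMeasure n) := by
  simp only [intervalIntegral.integral_of_le hab]
  exact integral_integral_swap
    (Integrable.of_bound hf.aestronglyMeasurable C (ae_of_all _ fun p => hC p.1 p.2))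

theorem integral_intervalIntegral_swap₂ {f : CSpace n → ℝ → ℝ → ℂ}
    (hf : Continuous fun p : (CSpace n × ℝ) × ℝ => f p.1.1 p.1.2 p.2) {C : ℝ}
    (hC : ∀ x y z, ‖f x y z‖ ≤ C) {a b : ℝ} (hab : a ≤ b) :
    ∫ x, (∫ y in a..b, ∫ z in a..b, f x y z) ∂(fockMeasure n) =
      ∫ y in a..b, ∫ z in a..b, ∫ x, f x y z ∂(fockMeasure n) := by
  rw [integral_intervalIntegral_swap (C := C * |b - a|) _ _ hab]
  · refine intervalIntegral.integral_congr fun y _ => ?_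
    exact integral_intervalIntegral_swap (f := fun x z => f x y z)
      (hf.comp (by fun_prop : Continuous fun p : CSpace n × ℝ => ((p.1, y), p.2)))
      (fun x z => hC x y z) hab
  · exact intervalIntegral.continuous_parametric_intervalIntegral_of_continuous' hf a b
  · exact fun x y => intervalIntegral.norm_integral_le_of_norm_le_const fun z _ => hC x y z

namespace FockSpace

variable {j : CSpace n →ₗᵢ[ℝ] CSpace n}

/-- The mean square of the orbit means over the sphere of radius `r`. -/
def orbitEnergy (j : CSpace n →ₗᵢ[ℝ] CSpace n) (k : ℤ) (r : ℝ) (F : FockSpace n) : ℝ :=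
  ∫ x, radialCutoff x * ‖orbitMean j k (radialMap r x) F‖ ^ 2 ∂(fockMeasure n)

theorem continuous_orbitEnergy_integrand (j : CSpace n →ₗᵢ[ℝ] CSpace n) (k : ℤ) (r : ℝ)
    (F : FockSpace n) :
    Continuous fun x => radialCutoff x * ‖orbitMean j k (radialMap r x) F‖ ^ 2 := by
  have h1 := (continuous_orbitMean j k F).comp (continuous_radialMap r)
  exact continuous_radialCutoff.mul (h1.norm.pow 2)

theorem norm_orbitMean_le (j : CSpace n →ₗᵢ[ℝ] CSpace n) (k : ℤ) (w : CSpace n)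
    (F : FockSpace n) : ‖orbitMean j k w F‖ ≤ ‖F‖ * |2 * Real.pi - 0| := by
  refine intervalIntegral.norm_integral_le_of_norm_le_const fun θ _ => ?_
  have h6 : ‖Complex.exp (k * θ * Complex.I)‖ = 1 := by
    have := Complex.norm_exp_ofReal_mul_I (k * θ)
    push_cast at this
    exact this
  rw [norm_smul, h6, one_mul, LinearIsometry.norm_map]

theorem integrable_orbitEnergy_integrand (j : CSpace n →ₗᵢ[ℝ] CSpace n) (k : ℤ) (r : ℝ)
    (F : FockSpace n) :
    Integrable (fun x => radialCutoff x * ‖orbitMean j k (radialMap r x) F‖ ^ 2)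
      (fockMeasure n) := by
  refine Integrable.of_bound (continuous_orbitEnergy_integrand j k r F).aestronglyMeasurable
    ((‖F‖ * |2 * Real.pi - 0|) ^ 2) (ae_of_all _ fun x => ?_)
  have h0 := radialCutoff_nonneg x
  have h1 := radialCutoff_le_one x
  have h2 := norm_orbitMean_le j k (radialMap r x) F
  rw [Real.norm_of_nonneg (by positivity)]
  calc _ ≤ 1 * ‖orbitMean j k (radialMap r x) F‖ ^ 2 := by gcongr
    _ ≤ _ := by rw [one_mul]; gcongr

/-- The part of the kernel of the orbit energy which depends only on `|w|`. -/
def orbitKernel (κ : ℝ) (k : ℤ) (φ θ t : ℝ) : ℂ :=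
  Complex.exp (k * (θ - φ) * Complex.I) * Complex.exp (Real.sin (θ - φ) * κ * t ^ 2 * Complex.I)

theorem norm_orbitKernel (κ : ℝ) (k : ℤ) (φ θ t : ℝ) : ‖orbitKernel κ k φ θ t‖ = 1 := by
  have h1 := Complex.norm_exp_ofReal_mul_I (k * (θ - φ))
  have h2 := Complex.norm_exp_ofReal_mul_I (Real.sin (θ - φ) * κ * t ^ 2)
  push_cast at h1 h2
  rw [orbitKernel, norm_mul]
  push_cast
  rw [h1, h2, one_mul]

/-- After averaging, the isometry in the chord formula is absorbed by a change of variables. What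
remains involves j only through κ and F only through the means of ⟪F, T(tw)F⟫. -/
theorem orbitEnergy_eq {κ : ℝ} (hj : ∀ x, j (j x) = -x)
    (hκ : ∀ x, (⟪j x, x⟫_ℂ).im = κ * ‖x‖ ^ 2) (k : ℤ) (r : ℝ) (F : FockSpace n) :
    (orbitEnergy j k r F : ℂ) =
      ∫ φ in (0 : ℝ)..2 * Real.pi, ∫ θ in (0 : ℝ)..2 * Real.pi,
        ∫ x, radialCutoff x * (orbitKernel κ k φ θ ‖radialMap r x‖ *
          ⟪F, translate ((2 * Real.sin ((θ - φ) / 2)) • radialMap r x) F⟫_ℂ) ∂(fockMeasure n) := by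
  have h1 : ∀ φ θ : ℝ, ∫ x, radialCutoff x * (orbitKernel κ k φ θ ‖radialMap r x‖ *
          ⟪F, translate ((2 * Real.sin ((θ - φ) / 2)) • radialMap r x) F⟫_ℂ) ∂(fockMeasure n) =
      ∫ x, radialCutoff x * (orbitKernel κ k φ θ ‖radialMap r x‖ *
          ⟪F, translate ((2 * Real.sin ((θ - φ) / 2)) •
            circleOrbit j ((θ + φ) / 2 + Real.pi / 2) (radialMap r x)) F⟫_ℂ) ∂(fockMeasure n) :=
    fun φ θ => (integral_radial_map r (circleOrbitIso hj ((θ + φ) / 2 + Real.pi / 2))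
      (orbitKernel κ k φ θ)
      (fun y => ⟪F, translate ((2 * Real.sin ((θ - φ) / 2)) • y) F⟫_ℂ)).symm
  simp only [h1]
  rw [← integral_intervalIntegral_swap₂ (C := ‖F‖ * ‖F‖) _ _ (by positivity), orbitEnergy]
  · refine (integral_ofReal (𝕜 := ℂ)).symm.trans (integral_congr_ae (ae_of_all _ fun x => ?_))
    have h2 := inner_orbitMean_self hκ k (radialMap r x) F
    rw [inner_self_eq_norm_sq_to_K] at h2
    simp only [intervalIntegral.integral_const_mul]
    push_cast
    congr 1
  · have h3 : Continuous fun p : (CSpace n × ℝ) × ℝ => radialMap r p.1.1 :=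
      (continuous_radialMap r).comp (by fun_prop)
    have h4 : Continuous fun p : (CSpace n × ℝ) × ℝ => radialCutoff p.1.1 :=
      continuous_radialCutoff.comp (by fun_prop)
    have h5 : Continuous fun p : (CSpace n × ℝ) × ℝ => (2 * Real.sin ((p.2 - p.1.2) / 2)) •
        circleOrbit j ((p.2 + p.1.2) / 2 + Real.pi / 2) (radialMap r p.1.1) := by
      have := j.continuous
      unfold circleOrbit
      fun_prop
    have h6 := (continuous_inner_translate F F).comp h5
    simp only [Function.comp_def] at h6
    unfold orbitKernel
    fun_prop
  · intro x φ θ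
    rw [norm_mul, norm_mul, norm_orbitKernel, one_mul, Complex.norm_real,
      Real.norm_of_nonneg (radialCutoff_nonneg x)]
    have h7 := norm_inner_le_norm (𝕜 := ℂ) F (translate ((2 * Real.sin ((θ - φ) / 2)) •
      circleOrbit j ((θ + φ) / 2 + Real.pi / 2) (radialMap r x)) F)
    rw [LinearIsometry.norm_map] at h7
    calc _ ≤ 1 * (‖F‖ * ‖F‖) := by
          gcongr
          exact radialCutoff_le_one x
      _ = _ := one_mul _

/-- Rotating F replaces w by cw in ⟪F, T(tw)F⟫, again an isometry under the spherical mean; no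
commutation of c with j is needed. -/
theorem orbitEnergy_rotate {κ : ℝ} (hj : ∀ x, j (j x) = -x)
    (hκ : ∀ x, (⟪j x, x⟫_ℂ).im = κ * ‖x‖ ^ 2) (k : ℤ) (r : ℝ) (c : ℂ) (hc : ‖c‖ = 1)
    (F : FockSpace n) : orbitEnergy j k r (rotate c hc F) = orbitEnergy j k r F := by
  rw [← Complex.ofReal_inj, orbitEnergy_eq hj hκ, orbitEnergy_eq hj hκ]
  refine intervalIntegral.integral_congr fun φ _ => intervalIntegral.integral_congr fun θ _ => ?_
  have h := integral_radial_map r (phaseIso n c hc) (orbitKernel κ k φ θ)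
      (fun y => ⟪F, translate ((2 * Real.sin ((θ - φ) / 2)) • y) F⟫_ℂ)
  simp only [inner_rotate_translate_rotate, phaseIso_apply, smul_comm c] at h ⊢
  exact h

/-- The joint kernel of the orbit means over a sphere is invariant under rotations. -/
theorem orbitMean_rotate_eq_zero {κ : ℝ} (hj : ∀ x, j (j x) = -x)
    (hκ : ∀ x, (⟪j x, x⟫_ℂ).im = κ * ‖x‖ ^ 2) {k : ℤ} {r : ℝ} (hr : 0 < r) {F : FockSpace n}
    (hF : ∀ w, ‖w‖ = r → orbitMean j k w F = 0) (c : ℂ) (hc : ‖c‖ = 1) {w : CSpace n}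
    (hw : ‖w‖ = r) : orbitMean j k w (rotate c hc F) = 0 := by
  have h0 : orbitEnergy j k r F = 0 := by
    refine (integral_congr_ae (ae_of_all _ fun x => ?_)).trans (integral_zero _ _)
    by_cases hx : radialCutoff x = 0
    · simp [hx]
    · simp [hF _ (norm_radialMap hr hx)]
  rw [← orbitEnergy_rotate hj hκ k r c hc, orbitEnergy, integral_eq_zero_iff_of_nonneg
    (fun x => mul_nonneg (radialCutoff_nonneg x) (by positivity))
    (integrable_orbitEnergy_integrand j k r _)] at h0
  have h1 := (Continuous.ae_eq_iff_eq (volume : Measure (CSpace n))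
    (continuous_orbitEnergy_integrand j k r _) continuous_zero).1 (ae_volume_of_ae h0)
  -- This point has norm 2, where the cutoff equals 1, and it projects radially to w.
  have h2 := congrFun h1 ((2 / r) • w)
  have h3 : ‖(2 / r) • w‖ = 2 := by
    rw [norm_smul, hw, Real.norm_of_nonneg (by positivity)]
    field_simp
  have h4 : radialMap r ((2 / r) • w) = w := by
    rw [radialMap, h3, max_eq_left one_le_two, smul_smul]
    have : r / 2 * (2 / r) = 1 := by field_simp
    rw [this, one_smul]
  have h5 : radialCutoff ((2 / r) • w) = 1 := by
    rw [radialCutoff, h3]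
    norm_num
  rw [h4, h5] at h2
  simpa using h2

/-- The orbit means over a sphere have no common kernel. -/
theorem eq_zero_of_orbitMean {κ : ℝ} (hj : ∀ x, j (j x) = -x)
    (hκ : ∀ x, (⟪j x, x⟫_ℂ).im = κ * ‖x‖ ^ 2) {r : ℝ} (hr : 0 < r) {k : ℤ}
    (hk : κ * r ^ 2 = -k) (hn : 1 < n ∨ n = 1 ∧ Odd k ∧ κ ^ 2 = 1) {F : FockSpace n}
    (hF : ∀ w, ‖w‖ = r → orbitMean j k w F = 0) : F = 0 := by
  refine ext fun ζ => eq_zero_of_twistedMean hj hκ hr hk hn F.differentiable ?_ ζ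
  intro w hw c hc ξ
  have h := orbitMean_apply hj k w (rotate c hc F) ξ
  rw [orbitMean_rotate_eq_zero hj hκ hr hF c hc hw] at h
  exact (mul_eq_zero.1 h.symm).resolve_left (Complex.exp_ne_zero _)

end FockSpace

end RotationInvariance

/-! ### Transitivity of the unitary group on the sphere. -/

section ComplexIsometry

variable {V : Type*} [NormedAddCommGroup V] [InnerProductSpace ℝ V]

/-- The complex linear isometries of a Euclidean space with an orthogonal complex structure act
transitively on the unit sphere. -/
theorem exists_isometry_commute_map_eq (j : V →ₗ[ℝ] V) (hj : ∀ x, j (j x) = -x)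
    (hskew : ∀ x y, ⟪j x, y⟫_ℝ = -⟪x, j y⟫_ℝ) {ν x : V} (hν : ‖ν‖ = 1) (hx : ‖x‖ = 1) :
    ∃ U : V →ₗᵢ[ℝ] V, (∀ y, U (j y) = j (U y)) ∧ U ν = x := by
  have hself : ∀ y, ⟪y, j y⟫_ℝ = 0 := fun y => by
    have h := hskew y y
    rw [real_inner_comm] at h
    linarith
  have hjj : ∀ y z, ⟪j y, j z⟫_ℝ = ⟪y, z⟫_ℝ := fun y z => by
    rw [hskew, hj, inner_neg_right, neg_neg]
  have hjn : ∀ y, ⟪j y, j y⟫_ℝ = ‖y‖ ^ 2 := fun y => by rw [hjj, real_inner_self_eq_norm_sq]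
  -- The map a + bj turns ν within its complex line so that its Hermitian product with x becomes
  -- real. The pair is the normalized (⟪ν, x⟫, ⟪jν, x⟫), or (1, 0) if both products vanish.
  obtain ⟨a, b, hab, hp⟩ : ∃ a b : ℝ, a ^ 2 + b ^ 2 = 1 ∧
      a * ⟪j ν, x⟫_ℝ - b * ⟪ν, x⟫_ℝ = 0 := by
    by_cases h0 : ⟪ν, x⟫_ℝ ^ 2 + ⟪j ν, x⟫_ℝ ^ 2 = 0
    · refine ⟨1, 0, by norm_num, ?_⟩
      have : ⟪j ν, x⟫_ℝ = 0 := by nlinarith [sq_nonneg ⟪ν, x⟫_ℝ, sq_nonneg ⟪j ν, x⟫_ℝ]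
      rw [this]
      ring
    · have h1 : 0 < ⟪ν, x⟫_ℝ ^ 2 + ⟪j ν, x⟫_ℝ ^ 2 := lt_of_le_of_ne (by positivity) (Ne.symm h0)
      refine ⟨⟪ν, x⟫_ℝ / √(⟪ν, x⟫_ℝ ^ 2 + ⟪j ν, x⟫_ℝ ^ 2),
        ⟪j ν, x⟫_ℝ / √(⟪ν, x⟫_ℝ ^ 2 + ⟪j ν, x⟫_ℝ ^ 2), ?_, by ring⟩
      rw [div_pow, div_pow, Real.sq_sqrt h1.le, ← add_div, div_self h0]
  let P : V →ₗᵢ[ℝ] V :=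
    { toLinearMap := a • LinearMap.id + b • j
      norm_map' := fun y => by
        change ‖a • y + b • j y‖ = ‖y‖
        rw [← sq_eq_sq₀ (norm_nonneg _) (norm_nonneg _), norm_add_sq_real, inner_smul_left,
          inner_smul_right, hself, norm_smul, norm_smul, mul_pow, mul_pow, Real.norm_eq_abs,
          Real.norm_eq_abs, sq_abs, sq_abs, ← real_inner_self_eq_norm_sq (j y), hjn]
        linear_combination ‖y‖ ^ 2 * hab }
  have hP : ∀ y, P y = a • y + b • j y := fun y => rfl
  have hPn : ‖P ν‖ = 1 := by rw [P.norm_map, hν]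
  have hPx : ⟪j (P ν), x⟫_ℝ = 0 := by
    rw [hP, map_add, map_smul, map_smul, hj, inner_add_left, inner_smul_left, inner_smul_left,
      inner_neg_left]
    simp only [conj_trivial]
    linarith
  -- The map S below is the complex reflection along v. It takes Pν to x because ⟪jv, Pν⟫ = 0. If v
  -- = 0 then c = 2/0 = 0 and S is the identity.
  obtain ⟨v, hv⟩ : ∃ v, v = x - P ν := ⟨_, rfl⟩
  obtain ⟨c, hc⟩ : ∃ c : ℝ, c = 2 / ‖v‖ ^ 2 := ⟨_, rfl⟩
  have hcv : c * c * ‖v‖ ^ 2 = 2 * c := by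
    rcases eq_or_ne (‖v‖ ^ 2) 0 with h | h
    · rw [hc, h]
      simp
    · rw [hc]
      field_simp
  let S : V →ₗᵢ[ℝ] V :=
    { toFun := fun y => y - c • (⟪v, y⟫_ℝ • v + ⟪j v, y⟫_ℝ • j v)
      map_add' := fun y z => by
        simp only [inner_add_right, add_smul, smul_add]
        abel
      map_smul' := fun t y => by
        simp only [inner_smul_right, mul_smul, smul_add, smul_sub, RingHom.id_apply,
          smul_comm c t]
      norm_map' := fun y => by
        change ‖y - c • (⟪v, y⟫_ℝ • v + ⟪j v, y⟫_ℝ • j v)‖ = ‖y‖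
        have h1 : ‖⟪v, y⟫_ℝ • v + ⟪j v, y⟫_ℝ • j v‖ ^ 2 =
            (⟪v, y⟫_ℝ ^ 2 + ⟪j v, y⟫_ℝ ^ 2) * ‖v‖ ^ 2 := by
          rw [norm_add_sq_real, inner_smul_left, inner_smul_right, hself, norm_smul, norm_smul,
            mul_pow, mul_pow, Real.norm_eq_abs, Real.norm_eq_abs, sq_abs, sq_abs,
            ← real_inner_self_eq_norm_sq (j v), hjn]
          ring
        rw [← sq_eq_sq₀ (norm_nonneg _) (norm_nonneg _), norm_sub_sq_real, norm_smul, mul_pow, h1,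
          inner_smul_right, inner_add_right, inner_smul_right, inner_smul_right,
          real_inner_comm v y, real_inner_comm (j v) y, Real.norm_eq_abs, sq_abs]
        linear_combination (⟪v, y⟫_ℝ ^ 2 + ⟪j v, y⟫_ℝ ^ 2) * hcv }
  have hS : ∀ y, S y = y - c • (⟪v, y⟫_ℝ • v + ⟪j v, y⟫_ℝ • j v) := fun y => rfl
  refine ⟨S.comp P, fun y => ?_, ?_⟩
  · have h1 : P (j y) = j (P y) := by simp only [hP, map_add, map_smul]
    have h2 : ∀ z, S (j z) = j (S z) := fun z => by
      rw [hS, hS, hjj, map_sub, map_smul, map_add, map_smul, map_smul, hj, hskew v z, neg_smul,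
        smul_neg, neg_neg, add_comm]
    change S (P (j y)) = j (S (P y))
    rw [h1, h2]
  · change S (P ν) = x
    rw [hS]
    have h1 : ⟪j v, P ν⟫_ℝ = 0 := by
      rw [hskew, hv, inner_sub_left, hself, sub_zero, real_inner_comm, hPx, neg_zero]
    have h2 : 2 * ⟪v, P ν⟫_ℝ = -‖v‖ ^ 2 := by
      have h3 : ‖v + P ν‖ ^ 2 = 1 := by rw [hv, sub_add_cancel, hx, one_pow]
      rw [norm_add_sq_real, hPn] at h3
      linarith
    rcases eq_or_ne v 0 with h | h
    · rw [h]
      simp only [inner_zero_left, smul_zero, map_zero, add_zero, sub_zero]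
      exact (sub_eq_zero.1 (hv ▸ h)).symm
    · have h4 : c * ⟪v, P ν⟫_ℝ = -1 := by
        have : ‖v‖ ^ 2 ≠ 0 := pow_ne_zero _ (norm_ne_zero_iff.2 h)
        rw [hc, div_mul_eq_mul_div, h2, neg_div, div_self this]
      rw [h1, zero_smul, add_zero, smul_smul, h4, neg_one_smul, sub_neg_eq_add, hv,
        add_sub_cancel]

end ComplexIsometry

/-! ### H-type relations and the helix in frame coordinates. -/

namespace HTypeAlgebra

variable {V Z : Type*} [NormedAddCommGroup V] [InnerProductSpace ℝ V] [FiniteDimensional ℝ V]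
  [NormedAddCommGroup Z] [InnerProductSpace ℝ Z] [FiniteDimensional ℝ Z]
  (A : HTypeAlgebra V Z) {n : ℕ}

theorem J_J (l : Z) (x : V) : A.J l (A.J l x) = -(‖l‖ ^ 2 • x) := A.bracketJ_sq l x

theorem bracket_neg (x y : V) : A.bracket x y = -A.bracket y x := by
  have h := A.bracket_self (x + y)
  simp only [map_add, LinearMap.add_apply, A.bracket_self, zero_add, add_zero] at h
  exact eq_neg_of_add_eq_zero_right h

theorem inner_J (l : Z) (x y : V) : ⟪A.J l x, y⟫_ℝ = ⟪l, A.bracket x y⟫_ℝ :=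
  inner_bracketJ _ _ _ _

theorem inner_J_left (l : Z) (x y : V) : ⟪A.J l x, y⟫_ℝ = -⟪x, A.J l y⟫_ℝ := by
  rw [real_inner_comm (A.J l y) x, inner_J, inner_J, A.bracket_neg, inner_neg_right]

theorem inner_J_J_self (l : Z) (x : V) : ⟪A.J l x, A.J l x⟫_ℝ = ‖l‖ ^ 2 * ‖x‖ ^ 2 := by
  rw [inner_J_left, J_J, inner_neg_right, neg_neg, inner_smul_right, real_inner_self_eq_norm_sq]

theorem norm_J (l : Z) (x : V) : ‖A.J l x‖ = ‖l‖ * ‖x‖ := by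
  rw [← sq_eq_sq₀ (norm_nonneg _) (by positivity), ← real_inner_self_eq_norm_sq,
    inner_J_J_self, mul_pow]

theorem J_add (l m : Z) (x : V) : A.J (l + m) x = A.J l x + A.J m x := by
  refine ext_inner_right ℝ fun y => ?_
  rw [inner_add_left, inner_J, inner_J, inner_J, inner_add_left]

/-- Polarization in l of |J_l x| = |l||x|. This is what makes Im⟪jx, x⟫ a constant multiple of |x|².
-/
theorem inner_J_J (l m : Z) (x : V) : ⟪A.J l x, A.J m x⟫_ℝ = ⟪l, m⟫_ℝ * ‖x‖ ^ 2 := by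
  have h := A.inner_J_J_self (l + m) x
  rw [J_add, real_inner_add_add_self, inner_J_J_self, inner_J_J_self, norm_add_sq_real] at h
  linarith

theorem J_mul_J (l : Z) : A.J l * A.J l = -(‖l‖ ^ 2 • (1 : V →L[ℝ] V)) :=
  ContinuousLinearMap.ext fun x => A.J_J l x

theorem inverse_J {l : Z} (hl : l ≠ 0) : Ring.inverse (A.J l) = -((‖l‖ ^ 2)⁻¹ • A.J l) := by
  have hl' : ‖l‖ ^ 2 ≠ 0 := pow_ne_zero _ (norm_ne_zero_iff.2 hl)
  let u : (V →L[ℝ] V)ˣ :=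
    { val := A.J l
      inv := -((‖l‖ ^ 2)⁻¹ • A.J l)
      val_inv := by
        rw [mul_neg, mul_smul_comm, J_mul_J, smul_neg, neg_neg, smul_smul, inv_mul_cancel₀ hl',
          one_smul]
      inv_val := by
        rw [neg_mul, smul_mul_assoc, J_mul_J, smul_neg, neg_neg, smul_smul, inv_mul_cancel₀ hl',
          one_smul] }
  exact Ring.inverse_unit u

/-- As J_l/|l| squares to -1, it defines an algebra map from ℂ to the endomorphisms of 𝔳, which
carries over Euler's formula. -/
theorem exp_smul_J {l : Z} (hl : l ≠ 0) (s : ℝ) : NormedSpace.exp (s • A.J l) =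
    Real.cos (s * ‖l‖) • (1 : V →L[ℝ] V) + (Real.sin (s * ‖l‖) / ‖l‖) • A.J l := by
  have hl' : ‖l‖ ≠ 0 := norm_ne_zero_iff.2 hl
  let _ : NormedAlgebra ℚ (V →L[ℝ] V) := NormedAlgebra.restrictScalars ℚ ℝ (V →L[ℝ] V)
  have hI : (‖l‖⁻¹ • A.J l) * (‖l‖⁻¹ • A.J l) = -1 := by
    rw [smul_mul_assoc, mul_smul_comm, J_mul_J, smul_neg, smul_neg, smul_smul, smul_smul]
    have : ‖l‖⁻¹ * ‖l‖⁻¹ * ‖l‖ ^ 2 = 1 := by field_simp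
    rw [this, one_smul]
  have hc : Continuous (Complex.liftAux (‖l‖⁻¹ • A.J l) hI) :=
    (Complex.liftAux (‖l‖⁻¹ • A.J l) hI).toLinearMap.continuous_of_finiteDimensional
  have h := NormedSpace.map_exp (Complex.liftAux (‖l‖⁻¹ • A.J l) hI) hc
    ((s * ‖l‖ : ℝ) * Complex.I)
  rw [← Complex.exp_eq_exp_ℂ, Complex.liftAux_apply, Complex.liftAux_apply,
    Complex.exp_ofReal_mul_I_re, Complex.exp_ofReal_mul_I_im, Complex.re_ofReal_mul,
    Complex.im_ofReal_mul, Complex.I_re, Complex.I_im, mul_zero, mul_one, map_zero, zero_add,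
    smul_smul, smul_smul, mul_assoc, mul_inv_cancel₀ hl', mul_one, Algebra.algebraMap_eq_smul_one,
    ← div_eq_mul_inv] at h
  exact h.symm

theorem helix_fst {l : Z} (hl : l ≠ 0) (ν : V) (s : ℝ) : (A.helix ν l s).1 =
    Real.cos (s * ‖l‖) • (-((‖l‖ ^ 2)⁻¹ • A.J l ν)) +
      Real.sin (s * ‖l‖) • (‖l‖⁻¹ • A.J l (-((‖l‖ ^ 2)⁻¹ • A.J l ν))) := by
  rw [helix, exp_smul_J A hl, inverse_J A hl]
  simp only [add_apply, smul_apply,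
    neg_apply, one_apply_eq_self, smul_smul, div_eq_mul_inv]

variable {A}

theorem re_inner_eq_inner_frame {μ : Z} (R : A.Frame μ n) (x y : CSpace n) :
    (⟪x, y⟫_ℂ).re = ⟪R.R x, R.R y⟫_ℝ := by
  have h := norm_add_sq_real (R.R x) (R.R y)
  rw [← map_add, R.R.norm_map, R.R.norm_map, R.R.norm_map] at h
  rw [re_inner_eq]
  linarith

/-- The complex structure `J_λ / |λ|` in the coordinates of a frame. -/
def frameStructure {μ : Z} (R : A.Frame μ n) (l : Z) (hl : l ≠ 0) : CSpace n →ₗᵢ[ℝ] CSpace n where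
  toFun x := R.R.symm (‖l‖⁻¹ • A.J l (R.R x))
  map_add' x y := by simp only [map_add, smul_add]
  map_smul' c x := by simp only [map_smul, smul_comm _ c, RingHom.id_apply]
  norm_map' x := by
    change ‖R.R.symm (‖l‖⁻¹ • A.J l (R.R x))‖ = ‖x‖
    rw [R.R.symm.norm_map, norm_smul, norm_J, R.R.norm_map, norm_inv, norm_norm,
      inv_mul_cancel_left₀ (norm_ne_zero_iff.2 hl)]

theorem frameStructure_apply {μ : Z} (R : A.Frame μ n) (l : Z) (hl : l ≠ 0) (x : CSpace n) :
    frameStructure R l hl x = R.R.symm (‖l‖⁻¹ • A.J l (R.R x)) := rfl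

theorem frameStructure_frameStructure {μ : Z} (R : A.Frame μ n) (l : Z) (hl : l ≠ 0)
    (x : CSpace n) : frameStructure R l hl (frameStructure R l hl x) = -x := by
  have hl' : ‖l‖ ≠ 0 := norm_ne_zero_iff.2 hl
  rw [frameStructure_apply, frameStructure_apply, LinearIsometryEquiv.apply_symm_apply, map_smul (A.J l),
    J_J, smul_neg, smul_neg, smul_smul, smul_smul]
  have : ‖l‖⁻¹ * ‖l‖⁻¹ * ‖l‖ ^ 2 = 1 := by field_simp
  rw [this, one_smul, map_neg, LinearIsometryEquiv.symm_apply_apply]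

/-- The imaginary part is minus the real product with ix, and the frame carries i to J_μ/|μ|. So κ
is minus the cosine of the angle between μ and λ. -/
theorem im_inner_frameStructure {μ : Z} (hμ : μ ≠ 0) (R : A.Frame μ n) (l : Z) (hl : l ≠ 0)
    (x : CSpace n) : (⟪frameStructure R l hl x, x⟫_ℂ).im = -(⟪μ, l⟫_ℝ / (‖μ‖ * ‖l‖)) * ‖x‖ ^ 2 := by
  have hl' : ‖l‖ ≠ 0 := norm_ne_zero_iff.2 hl
  have hμ' : ‖μ‖ ≠ 0 := norm_ne_zero_iff.2 hμ
  have h1 : (⟪frameStructure R l hl x, Complex.I • x⟫_ℂ).re =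
      -(⟪frameStructure R l hl x, x⟫_ℂ).im := by
    rw [inner_smul_right, Complex.I_mul_re]
  have h2 : R.R (Complex.I • x) = ‖μ‖⁻¹ • A.J μ (R.R x) := by
    rw [R.map_I_smul, smul_smul, inv_mul_cancel₀ hμ', one_smul]
  have h3 : R.R (frameStructure R l hl x) = ‖l‖⁻¹ • A.J l (R.R x) := by
    rw [frameStructure_apply, LinearIsometryEquiv.apply_symm_apply]
  rw [re_inner_eq_inner_frame R, h2, h3, inner_smul_left, inner_smul_right, inner_J_J,
    R.R.norm_map, real_inner_comm, conj_trivial] at h1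
  rw [← neg_eq_iff_eq_neg.2 h1]
  field_simp

/-- The base point of the helix in the coordinates of Fock space. -/
def helixBase {μ : Z} (R : A.Frame μ n) (ν : V) (l : Z) : CSpace n :=
  √(‖μ‖ / 2) • R.R.symm (-((‖l‖ ^ 2)⁻¹ • A.J l ν))

/-- Compatibility turns the central phase s⟪μ, λ⟫/(2|λ|²) into kθ with θ = s|λ|, so one turn of the
helix is the full circle [0, 2π]. -/
theorem rep_helix {μ : Z} (hμ : μ ≠ 0) (R : A.Frame μ n) {ν : V} (hν : ‖ν‖ = 1) {l : Z}
    (hl : l ≠ 0) {k : ℤ} (hk : ⟪μ, l⟫_ℝ = 2 * (k : ℝ) * ‖l‖ ^ 3) (F : FockSpace n) (s : ℝ) :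
    rep R (A.helix ν l s) F = Complex.exp (k * (s * ‖l‖ : ℝ) * Complex.I) •
      FockSpace.translate (circleOrbit (frameStructure R l hl) (s * ‖l‖) (helixBase R ν l)) F := by
  have hl' : ‖l‖ ≠ 0 := norm_ne_zero_iff.2 hl
  have hμ' : ‖μ‖ ≠ 0 := norm_ne_zero_iff.2 hμ
  have h1 : ‖μ‖ * (⟪μ, (A.helix ν l s).2⟫_ℝ / ‖μ‖) = k * (s * ‖l‖) := by
    rw [helix, inner_smul_right, hk, hν]
    field_simp
  have h2 : √(‖μ‖ / 2) • R.R.symm (A.helix ν l s).1 =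
      circleOrbit (frameStructure R l hl) (s * ‖l‖) (helixBase R ν l) := by
    rw [helix_fst A hl, circleOrbit, helixBase, map_smul (frameStructure R l hl),
      frameStructure_apply, LinearIsometryEquiv.apply_symm_apply, map_add, smul_add,
      map_smul R.R.symm (Real.cos _), map_smul R.R.symm (Real.sin _), smul_comm, smul_comm (√_)]
  change Complex.exp ((‖μ‖ * (⟪μ, (A.helix ν l s).2⟫_ℝ / ‖μ‖) : ℝ) * Complex.I) •
    FockSpace.translate (√(‖μ‖ / 2) • R.R.symm (A.helix ν l s).1) F = _
  rw [h1, h2]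
  push_cast
  rfl

theorem multiplier_apply {μ : Z} (hμ : μ ≠ 0) (R : A.Frame μ n) {ν : V} (hν : ‖ν‖ = 1) {l : Z}
    (hl : l ≠ 0) {k : ℤ} (hk : ⟪μ, l⟫_ℝ = 2 * (k : ℝ) * ‖l‖ ^ 3) (F : FockSpace n) :
    multiplier R ν l F = ((2 * Real.pi)⁻¹ : ℝ) •
      FockSpace.orbitMean (frameStructure R l hl) k (helixBase R ν l) F := by
  have hl' : ‖l‖ ≠ 0 := norm_ne_zero_iff.2 hl
  change ((‖l‖ / (2 * Real.pi) : ℝ) : ℂ) • (∫ s in Set.Ioc 0 (2 * Real.pi / ‖l‖),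
    rep R (A.helix ν l s) F) = _
  rw [← intervalIntegral.integral_of_le (by positivity)]
  simp only [rep_helix hμ R hν hl hk]
  rw [intervalIntegral.integral_comp_mul_right (fun θ : ℝ => Complex.exp (k * (θ : ℝ) * Complex.I) •
      FockSpace.translate (circleOrbit (frameStructure R l hl) θ (helixBase R ν l)) F) hl',
    zero_mul, div_mul_cancel₀ _ hl', ← FockSpace.orbitMean, Complex.coe_smul, smul_smul]
  congr 1
  field_simp

theorem exists_helixBase_eq {μ : Z} (hμ : μ ≠ 0) (R : A.Frame μ n) {l : Z} (hl : l ≠ 0)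
    {w : CSpace n} (hw : ‖w‖ = √(‖μ‖ / 2) / ‖l‖) : ∃ x : V, ‖x‖ = 1 ∧ helixBase R x l = w := by
  have hl' : ‖l‖ ≠ 0 := norm_ne_zero_iff.2 hl
  have hμ' : 0 < ‖μ‖ := norm_pos_iff.2 hμ
  have hs : √(‖μ‖ / 2) ≠ 0 := (Real.sqrt_pos.2 (by positivity)).ne'
  -- The equation for the base point solved for ν, with J_λ² = -|λ|².
  refine ⟨(√(‖μ‖ / 2))⁻¹ • A.J l (R.R w), ?_, ?_⟩
  · rw [norm_smul, norm_J, R.R.norm_map, hw, norm_inv, Real.norm_of_nonneg (Real.sqrt_nonneg _)]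
    field_simp
  · have h1 : (‖l‖ ^ 2)⁻¹ * (√(‖μ‖ / 2))⁻¹ * ‖l‖ ^ 2 = (√(‖μ‖ / 2))⁻¹ := by field_simp
    rw [helixBase, map_smul, J_J, smul_neg, smul_neg, neg_neg, smul_smul, smul_smul, h1,
      map_smul, LinearIsometryEquiv.symm_apply_apply, smul_smul, mul_inv_cancel₀ hs, one_smul]

variable (A) in
theorem exists_unitary_map_eq {l : Z} (hl : l ≠ 0) {ν x : V} (hν : ‖ν‖ = 1) (hx : ‖x‖ = 1) :
    ∃ U : A.unitarySubgroup l, (U : V →L[ℝ] V) ν = x := by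
  have hl' : ‖l‖ ≠ 0 := norm_ne_zero_iff.2 hl
  obtain ⟨U, hUJ, hU⟩ := exists_isometry_commute_map_eq
    ((‖l‖⁻¹ • A.J l : V →L[ℝ] V) : V →ₗ[ℝ] V) (fun y => by
      simp only [ContinuousLinearMap.coe_coe, smul_apply, map_smul, J_J,
        smul_neg, smul_smul]
      have : ‖l‖⁻¹ * (‖l‖⁻¹ * ‖l‖ ^ 2) = 1 := by field_simp
      rw [this, one_smul]) (fun y z => by
      simp only [ContinuousLinearMap.coe_coe, smul_apply, inner_smul_left,
        inner_smul_right, conj_trivial, inner_J_left, mul_neg]) hν hx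
  refine ⟨⟨Unitary.linearIsometryEquiv.symm (U.toLinearIsometryEquiv rfl), ?_⟩, hU⟩
  refine ContinuousLinearMap.ext fun y => ?_
  change U (A.J l y) = A.J l (U y)
  have h := hUJ y
  simp only [ContinuousLinearMap.coe_coe, smul_apply, map_smul] at h
  exact smul_right_injective V (inv_ne_zero hl') h

/-! ### The kernel of the averaged normal operator. -/

theorem adjoint_normalOp {μ : Z} (R : A.Frame μ n) (ν : V) (l : Z) :
    ContinuousLinearMap.adjoint (normalOp R ν l) = normalOp R ν l := by
  rw [normalOp, ContinuousLinearMap.adjoint_comp, ContinuousLinearMap.adjoint_adjoint]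

theorem adjoint_averagedNormalOp {μ : Z} (R : A.Frame μ n) (ν : V) (l : Z) :
    ContinuousLinearMap.adjoint (averagedNormalOp R ν l) = averagedNormalOp R ν l :=
  adjoint_strongIntegral _ _ _ _ _ _ _ fun _ => adjoint_normalOp R _ l

theorem inner_normalOp {μ : Z} (R : A.Frame μ n) (ν : V) (l : Z) (F : FockSpace n) :
    ⟪F, normalOp R ν l F⟫_ℂ = (‖multiplier R ν l F‖ ^ 2 : ℝ) := by
  rw [normalOp, ContinuousLinearMap.comp_apply, ContinuousLinearMap.adjoint_inner_right,
    inner_self_eq_norm_sq_to_K]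
  push_cast
  rfl

instance (l : Z) : (A.unitaryHaar l).IsOpenPosMeasure :=
  inferInstanceAs (Measure.haarMeasure
    (⊤ : TopologicalSpace.PositiveCompacts (A.unitarySubgroup l))).IsOpenPosMeasure

/-- The kernel of the averaged normal operator is the joint kernel of the multipliers. -/
theorem multiplier_eq_zero_of_averagedNormalOp_eq_zero {μ : Z} (R : A.Frame μ n) (ν : V) (l : Z)
    {F : FockSpace n} (h : averagedNormalOp R ν l F = 0) (U : A.unitarySubgroup l) :
    multiplier R ((U : V →L[ℝ] V) ν) l F = 0 := by
  have hc : Continuous fun U : A.unitarySubgroup l => normalOp R ((U : V →L[ℝ] V) ν) l F :=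
    (continuous_normalOp R l F).comp
      (by fun_prop : Continuous fun U : A.unitarySubgroup l => (U : V →L[ℝ] V) ν)
  have hi : Integrable (fun U : A.unitarySubgroup l => normalOp R ((U : V →L[ℝ] V) ν) l F)
      (A.unitaryHaar l) :=
    integrable_of_strong (fun F => ((continuous_normalOp R l F).comp (by fun_prop :
      Continuous fun U : A.unitarySubgroup l => (U : V →L[ℝ] V) ν)).aestronglyMeasurable)
      (fun _ => norm_normalOp_le R _ l) F
  have hN : ∀ U : A.unitarySubgroup l, ‖multiplier R ((U : V →L[ℝ] V) ν) l F‖ ^ 2 =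
      (⟪F, normalOp R ((U : V →L[ℝ] V) ν) l F⟫_ℂ).re := fun U => by
    rw [inner_normalOp, Complex.ofReal_re]
  have hNc : Continuous fun U : A.unitarySubgroup l =>
      ‖multiplier R ((U : V →L[ℝ] V) ν) l F‖ ^ 2 := by
    simp only [hN]
    exact Complex.continuous_re.comp (continuous_const.inner hc)
  have hNi : Integrable (fun U : A.unitarySubgroup l =>
      ‖multiplier R ((U : V →L[ℝ] V) ν) l F‖ ^ 2) (A.unitaryHaar l) :=
    hNc.integrable_of_hasCompactSupport (HasCompactSupport.of_compactSpace _)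
  -- This integral is the inner product of F with the averaged operator applied to F.
  have h1 : ∫ U, ‖multiplier R ((U : V →L[ℝ] V) ν) l F‖ ^ 2 ∂(A.unitaryHaar l) = 0 := by
    have h2 := integral_inner (𝕜 := ℂ) hi F
    have h3 : ∫ U : A.unitarySubgroup l, normalOp R ((U : V →L[ℝ] V) ν) l F ∂(A.unitaryHaar l) =
        0 := h
    rw [h3, inner_zero_right] at h2
    simp only [inner_normalOp] at h2
    rw [← Complex.ofReal_inj, Complex.ofReal_zero, ← h2]
    exact (integral_ofReal (𝕜 := ℂ)).symm
  rw [integral_eq_zero_iff_of_nonneg (fun _ => by positivity) hNi] at h1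
  have h3 := congrFun ((Continuous.ae_eq_iff_eq _ hNc continuous_zero).1 h1) U
  simpa using h3

theorem averagedNormalOp_injective {μ : Z} (hμ : μ ≠ 0) (R : A.Frame μ n) {ν : V} (hν : ‖ν‖ = 1)
    {l : Z} (hl : l ≠ 0) {k : ℤ} (hk : ⟪μ, l⟫_ℝ = 2 * (k : ℝ) * ‖l‖ ^ 3)
    (hn : 1 < n ∨ n = 1 ∧ Odd k ∧ (⟪μ, l⟫_ℝ / (‖μ‖ * ‖l‖)) ^ 2 = 1) :
    Function.Injective (averagedNormalOp R ν l) := by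
  have hl' : 0 < ‖l‖ := norm_pos_iff.2 hl
  have hμ' : 0 < ‖μ‖ := norm_pos_iff.2 hμ
  have hr : 0 < √(‖μ‖ / 2) / ‖l‖ := div_pos (Real.sqrt_pos.2 (by positivity)) hl'
  refine (injective_iff_map_eq_zero _).2 fun F hF => ?_
  refine FockSpace.eq_zero_of_orbitMean (frameStructure_frameStructure R l hl)
    (im_inner_frameStructure hμ R l hl) hr (k := k) ?_ (by rwa [neg_sq]) fun w hw => ?_
  -- With r² = |μ|/(2|λ|²) and κ = -⟪μ, λ⟫/(|μ||λ|), compatibility is exactly κr² = -k.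
  · rw [hk, div_pow, Real.sq_sqrt (by positivity)]
    field_simp
  · obtain ⟨x, hx, rfl⟩ := exists_helixBase_eq hμ R hl hw
    obtain ⟨U, rfl⟩ := A.exists_unitary_map_eq hl hν hx
    have h := multiplier_eq_zero_of_averagedNormalOp_eq_zero R ν l hF U
    rw [multiplier_apply hμ R hx hl hk] at h
    exact (smul_eq_zero.1 h).resolve_left (by positivity)

end HTypeAlgebra

/-- The orthogonal complement of the range is the kernel of the adjoint, here the kernel of T
itself. -/
theorem hasDenselyDefinedInverse_of_injective {H : Type*} [NormedAddCommGroup H]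
    [InnerProductSpace ℂ H] [CompleteSpace H] {T : H →L[ℂ] H}
    (hT : ContinuousLinearMap.adjoint T = T) (hinj : Function.Injective T) :
    HasDenselyDefinedInverse T := by
  refine ⟨hinj, ?_⟩
  have h1 : T.rangeᗮ = ⊥ := by
    rw [ContinuousLinearMap.orthogonal_range, hT]
    exact LinearMap.ker_eq_bot.2 hinj
  have h2 := (Submodule.topologicalClosure_eq_top_iff (K := T.range)).2 h1
  exact Submodule.dense_iff_topologicalClosure_eq_top.2 h2

end

theorem mainTheorem6 {V Z : Type*} [NormedAddCommGroup V] [InnerProductSpace ℝ V]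
    [FiniteDimensional ℝ V] [NormedAddCommGroup Z] [InnerProductSpace ℝ Z]
    [FiniteDimensional ℝ Z] (A : HTypeAlgebra V Z) (n : ℕ)
    (l : Z) (hl : l ≠ 0) (ν : V) (hν : ‖ν‖ = 1) :
    (n = 1 → ∀ k : ℤ, Odd k → ∀ μ : Z, μ = (2 * (k : ℝ) * ‖l‖) • l →
      ∀ R : A.Frame μ n, HasDenselyDefinedInverse (HTypeAlgebra.averagedNormalOp R ν l)) ∧
    (1 < n → ∀ μ : Z, μ ≠ 0 → (∃ k : ℤ, ⟪μ, l⟫_ℝ = 2 * (k : ℝ) * ‖l‖ ^ 3) →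
      ∀ R : A.Frame μ n, HasDenselyDefinedInverse (HTypeAlgebra.averagedNormalOp R ν l)) := by
  have hl' : ‖l‖ ≠ 0 := norm_ne_zero_iff.2 hl
  refine ⟨fun hn k hk μ hμ R => ?_, fun hn μ hμ ⟨k, hk⟩ R => ?_⟩ <;>
    refine hasDenselyDefinedInverse_of_injective (HTypeAlgebra.adjoint_averagedNormalOp R ν l) ?_
  · have hk0 : (k : ℝ) ≠ 0 := by
      rw [Int.cast_ne_zero]
      rintro rfl
      simp at hk
    have hμl : ⟪μ, l⟫_ℝ = 2 * (k : ℝ) * ‖l‖ ^ 3 := by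
      rw [hμ, inner_smul_left, real_inner_self_eq_norm_sq, conj_trivial]
      ring
    have hμn : ‖μ‖ ^ 2 = (2 * (k : ℝ) * ‖l‖) ^ 2 * ‖l‖ ^ 2 := by
      rw [hμ, norm_smul, mul_pow, Real.norm_eq_abs, sq_abs]
    have hμ0 : μ ≠ 0 := by
      rw [hμ]
      exact smul_ne_zero (by positivity) hl
    -- Here μ is a multiple of λ, so the cosine is ±1 and κ² = 1.
    refine HTypeAlgebra.averagedNormalOp_injective hμ0 R hν hl hμl (Or.inr ⟨hn, hk, ?_⟩)
    rw [hμl, div_pow, mul_pow ‖μ‖, hμn]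
    field_simp
  · exact HTypeAlgebra.averagedNormalOp_injective hμ R hν hl hk (Or.inl hn)
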